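/- Let $\kappa$ be a weakly compact cardinal, i.e. an uncountable cardinal with $\kappa\to(\kappa)^2_2$. Then the embeddability relation $\sqsubseteq^\kappa_{\mathsf{GRAPH}}$ between graphs of size $\kappa$ is complete for analytic quasi-orders; that is, $\sqsubseteq^\kappa_{\mathsf{GRAPH}}$ is an analytic quasi-order on a standard Borel $\kappa$-space, and every analytic quasi-order $R$ on a standard Borel $\kappa$-space $X$ is Borel reducible to it. Here, for a set $I$ of size $\kappa$ and a set $A$, the set ${}^I A$ of functions from $I$ to $A$ carries the bounded topology, generated by the sets $\{x\in{}^I A : s\subseteq x\}$ with $s$ a partial function from $I$ to $A$ whose domain has size $<\kappa$. The Borel sets of a topological space are the members of the smallest class of subsets containing the open sets and closed under complements and unions of at most $\kappa$ sets; a map is Borel if preimages of open sets are Borel, and two spaces are Borel isomorphic if there is a bijection between them that is Borel in both directions. A standard Borel $\kappa$-space is a topological space with a basis of size at most $\kappa$ that is Borel isomorphic to a Borel subset of ${}^\kappa\kappa$. A subset of such a space is analytic if it is a continuous image of a closed subset of ${}^\kappa\kappa$. An analytic quasi-order on a standard Borel $\kappa$-space $X$ is a reflexive and transitive relation $R$ on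 $X$ that is analytic as a subset of $X\times X$. If $R$ and $S$ are relations on $X$ and $Y$ respectively, $R$ is Borel reducible to $S$ if there is a Borel map $f\colon X\to Y$ such that $x_0\mathrel{R}x_1\iff f(x_0)\mathrel{S}f(x_1)$ for all $x_0,x_1\in X$. The relation $\sqsubseteq^\kappa_{\mathsf{GRAPH}}$ lives on the space of all graphs (symmetric irreflexive binary relations) with domain $\kappa$, topologized as a subspace of ${}^{\kappa\times\kappa}2$, and $G\sqsubseteq H$ means that there is an injection $g\colon\kappa\to\kappa$ such that, for all $\alpha,\beta<\kappa$, $\alpha$ and $\beta$ are adjacent in $G$ if and only if $g(\alpha)$ and $g(\beta)$ are adjacent in $H$. -/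

import Mathlib

open Cardinal Set TopologicalSpace

universe u v

namespace KappaDST

/-- The set of ordinals below `κ`, i.e. the cardinal `κ` regarded as a set (an initial ordinal). -/
abbrev Pt (κ : Cardinal.{u}) : Type u := κ.ord.ToType

/-- An uncountable cardinal `κ` is weakly compact if `κ → (κ)²₂`: every colouring of the
two-element subsets of `κ` with two colours has a homogeneous set of cardinality `κ`. -/
def IsWeaklyCompact (κ : Cardinal.{u}) : Prop :=
  ℵ₀ < κ ∧
    ∀ f : {s : Finset (Pt κ) // s.card = 2} → Fin 2,
      ∃ H : Set (Pt κ), #H = κ ∧ ∃ c : Fin 2,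
        ∀ s : {s : Finset (Pt κ) // s.card = 2}, (s.1 : Set (Pt κ)) ⊆ H → f s = c

/-- The set of all functions from `I` to `A`, to be endowed with the bounded topology. -/
def BSpace (_κ : Cardinal.{u}) (I : Type u) (A : Type v) : Type (max u v) := I → A

/-- The bounded topology on the set of functions from `I` to `A`: it is generated by the sets
`N_s = {x | s ⊆ x}`, where `s` is a partial function from `I` to `A` whose domain `d` has
cardinality `< κ` (the total function `s` below only matters on `d`). When `κ` is regular and
`I = κ` this is also the topology generated by the `N_s` with `s` a sequence of length `< κ`,
since subsets of `κ` of size `< κ` are then bounded. -/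
instance (κ : Cardinal.{u}) (I : Type u) (A : Type v) : TopologicalSpace (BSpace κ I A) :=
  generateFrom
    {N | ∃ (d : Set I) (s : I → A), #d < κ ∧ N = {x : BSpace κ I A | ∀ i ∈ d, x i = s i}}

/-- The generalized Baire space: all functions from `κ` to `κ`, with the bounded topology. -/
abbrev Baire (κ : Cardinal.{u}) : Type u := BSpace κ (Pt κ) (Pt κ)

/-- The `lam`-Borel subsets of a topological space: the smallest class of sets containing the open
sets and closed under complements and unions of fewer than `lam` sets. -/
inductive IsLamBorel (lam : Cardinal.{u}) {X : Type u} [TopologicalSpace X] : Set X → Prop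
  | of_isOpen (U : Set X) : IsOpen U → IsLamBorel lam U
  | compl (B : Set X) : IsLamBorel lam B → IsLamBorel lam Bᶜ
  | sUnion (S : Set (Set X)) : #S < lam → (∀ B ∈ S, IsLamBorel lam B) → IsLamBorel lam (⋃₀ S)

/-- Borel sets (relative to `κ`) are the `κ⁺`-Borel sets. -/
def IsBorelSet (κ : Cardinal.{u}) {X : Type u} [TopologicalSpace X] (B : Set X) : Prop :=
  IsLamBorel (Order.succ κ) B

/-- Borel functions (relative to `κ`). -/
def IsBorelMap (κ : Cardinal.{u}) {X Y : Type u} [TopologicalSpace X] [TopologicalSpace Y]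
    (f : X → Y) : Prop :=
  ∀ U : Set Y, IsOpen U → IsBorelSet κ (f ⁻¹' U)

/-- Two spaces are Borel isomorphic (relative to `κ`). -/
def BorelIsomorphic (κ : Cardinal.{u}) (X Y : Type u) [TopologicalSpace X] [TopologicalSpace Y] :
    Prop :=
  ∃ e : X ≃ Y, IsBorelMap κ e ∧ IsBorelMap κ e.symm

/-- A `κ`-space is a topological space with a basis of size at most `κ`. -/
def IsKappaSpace (κ : Cardinal.{u}) (X : Type u) [TopologicalSpace X] : Prop :=
  ∃ B : Set (Set X), IsTopologicalBasis B ∧ #B ≤ κ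

/-- A standard Borel `κ`-space is a `κ`-space which is Borel isomorphic to a Borel subset of the
generalized Baire space (with the subspace topology). -/
def IsStandardBorel (κ : Cardinal.{u}) (X : Type u) [TopologicalSpace X] : Prop :=
  IsKappaSpace κ X ∧ ∃ B : Set (Baire κ), IsBorelSet κ B ∧ BorelIsomorphic κ X B

/-- A set is analytic if it is a continuous image of a closed subset of the generalized Baire
space. -/
def IsAnalytic (κ : Cardinal.{u}) {X : Type u} [TopologicalSpace X] (A : Set X) : Prop :=
  ∃ C : Set (Baire κ), IsClosed C ∧ ∃ f : C → X, Continuous f ∧ range f = A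

/-- `R` is an analytic quasi-order on the standard Borel `κ`-space `X`. -/
structure IsAnalyticQO (κ : Cardinal.{u}) {X : Type u} [TopologicalSpace X]
    (R : X → X → Prop) : Prop where
  standardBorel : IsStandardBorel κ X
  refl : ∀ x, R x x
  trans : ∀ x y z, R x y → R y z → R x z
  analytic : IsAnalytic κ {p : X × X | R p.1 p.2}

/-- `R ≤_B S`: there is a Borel reduction of `R` to `S`. -/
def BorelReducible (κ : Cardinal.{u}) {X Y : Type u} [TopologicalSpace X] [TopologicalSpace Y]
    (R : X → X → Prop) (S : Y → Y → Prop) : Prop :=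
  ∃ f : X → Y, IsBorelMap κ f ∧ ∀ x₀ x₁ : X, R x₀ x₁ ↔ S (f x₀) (f x₁)

/-- An analytic quasi-order `S` is complete if every analytic quasi-order, on any standard Borel
`κ`-space, is Borel reducible to it. -/
def IsCompleteAnalyticQO (κ : Cardinal.{u}) {Y : Type u} [TopologicalSpace Y]
    (S : Y → Y → Prop) : Prop :=
  IsAnalyticQO κ S ∧
    ∀ (X : Type u) [TopologicalSpace X] (R : X → X → Prop),
      IsAnalyticQO κ R → BorelReducible κ R S

/-- The set of all graphs with domain `κ`. -/
def GraphSpace (κ : Cardinal.{u}) : Type u := SimpleGraph (Pt κ)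

/-- The code of a graph with domain `κ`: the characteristic function on `κ × κ` of its edge
relation, with the two truth values as the two-element set. -/
def GraphSpace.code {κ : Cardinal.{u}} (G : GraphSpace κ) :
    BSpace κ (Pt κ × Pt κ) Prop :=
  fun p => SimpleGraph.Adj G p.1 p.2

/-- The space of graphs with domain `κ` is topologized as a subspace of the space of all
structures with one binary relation, i.e. of the space of functions from `κ × κ` to `2` with the
bounded topology. -/
instance (κ : Cardinal.{u}) : TopologicalSpace (GraphSpace κ) :=
  induced GraphSpace.code inferInstance

/-- The embeddability relation between graphs with domain `κ`: there is an injection which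
preserves adjacency and non-adjacency. -/
def GraphEmbeddable (κ : Cardinal.{u}) (G H : GraphSpace κ) : Prop :=
  Nonempty (SimpleGraph.Embedding (V := Pt κ) (W := Pt κ) G H)

end KappaDST

/-! Weak compactness enters only through inaccessibility of κ (`IsWeaklyCompact.isInaccessible`). A
point of `X` is coded by the set of basic open sets containing it, and on codes `R` becomes the
projection of a closed relation `D z w ξ`: it holds as soon as, for every α < κ, the restrictions of
`z`, `w`, `ξ` to α extend to a triple in `D` (`exists_codes_pair`).

The essential vertices of the graph of `x` are its valid nodes: at level α, a start f↾α together
with a finite chain of approximate `D`-steps leading from it to x↾α. A node is joined to its valid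
restrictions and to a label coding its level and its start. If ξ witnesses `R x y`, appending the
step (ξ, y) to every chain embeds the graph of `x` into that of `y`, the labels being unaffected
because levels and starts do not change (`vtxEmbedding`).

Conversely, an embedding that fixes these labels sends the empty chain at x↾α to a chain from x↾α to
y↾α. Edges between comparable nodes make these chains coherent. Being finite, they have one common
length and glue to a single list; closedness of `D` makes it a true `D`-chain from `x` to `y`
(`reflTransGen_of_embedding`), and transitivity of `R` collapses the chain to `R x y`.

Labels are made rigid by ladders, i.e. ω-sequences cofinal in ordinals δ. If δ is closed under a
suitable function, a top over δ can only go to a top over δ, since no other vertex has infinitely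
many pairwise non-adjacent neighbours of the required ranks (`exists_map_top_eq`). A pressing-down
argument gives a place n₀ such that unboundedly many ρ are the n₀-th rung of stationarily many
ladders (`exists_stationary_fibres`); the labels of these ρ are fixed by every embedding
(`map_lab_eq`), and there are enough of them to code all levels and starts (`exists_node_code`). -/

namespace KappaDST

/-! ### Weakly compact cardinals are inaccessible -/

section WeaklyCompact

variable {κ : Cardinal.{u}}

/-- The partition property, stated for binary relations instead of colourings of pairs. -/
theorem IsWeaklyCompact.exists_homogeneous (hκ : IsWeaklyCompact κ) (r : Pt κ → Pt κ → Prop) :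
    ∃ H : Set (Pt κ), #H = κ ∧
      ((∀ x ∈ H, ∀ y ∈ H, x < y → r x y) ∨ (∀ x ∈ H, ∀ y ∈ H, x < y → ¬ r x y)) := by
  classical
  obtain ⟨H, hH, c, hc⟩ := hκ.2 fun s =>
    if ∃ x y, x < y ∧ s.1 = {x, y} ∧ r x y then 1 else 0
  refine ⟨H, hH, ?_⟩
  have key : ∀ x ∈ H, ∀ y ∈ H, x < y → ((r x y → c = 1) ∧ (¬ r x y → c = 0)) := by
    intro x hx y hy hxy
    have h := hc ⟨{x, y}, Finset.card_pair hxy.ne⟩ (by simp [Set.insert_subset_iff, hx, hy])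
    refine ⟨fun hr => ?_, fun hr => ?_⟩
    · rw [← h, if_pos ⟨x, y, hxy, rfl, hr⟩]
    · rw [← h, if_neg]
      rintro ⟨x', y', hxy', he : ({x, y} : Finset (Pt κ)) = {x', y'}, hr'⟩
      have h1 : x' = x ∨ x' = y := by
        have : x' ∈ ({x, y} : Finset (Pt κ)) := by rw [he]; simp
        simpa using this
      have h2 : y' = x ∨ y' = y := by
        have : y' ∈ ({x, y} : Finset (Pt κ)) := by rw [he]; simp
        simpa using this
      rcases h1 with rfl | rfl <;> rcases h2 with rfl | rfl
      · exact lt_irrefl _ hxy'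
      · exact hr hr'
      · exact lt_asymm hxy hxy'
      · exact lt_irrefl _ hxy'
  by_cases hc1 : c = 1
  · left
    intro x hx y hy hxy
    by_contra hr
    have := (key x hx y hy hxy).2 hr
    simp [hc1] at this
  · right
    intro x hx y hy hxy hr
    exact hc1 ((key x hx y hy hxy).1 hr)

theorem mk_Iio_pt_lt (a : Pt κ) : #(Iio a) < κ := by simpa using mk_Iio_lt a

theorem mk_Iic_pt_lt (h : ℵ₀ ≤ κ) (a : Pt κ) : #(Iic a) < κ := by
  rw [← Iio_insert]
  exact (mk_insert_le).trans_lt (add_lt_of_lt h (mk_Iio_pt_lt a) (one_lt_aleph0.trans_le h))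

/-- Send each point to an element above it in a cofinal set of size less than κ, and colour a pair
by whether the two images agree. Constancy on a homogeneous set would bound it; injectivity would
make it too small. -/
theorem IsWeaklyCompact.isRegular (hκ : IsWeaklyCompact κ) : κ.IsRegular := by
  have h0 : ℵ₀ ≤ κ := hκ.1.le
  refine ⟨h0, ?_⟩
  rw [← Ordinal.cof_toType, Order.le_cof_iff]
  intro S hS
  by_contra! hlt
  have hp : ∀ x : Pt κ, ∃ s : S, x ≤ s := fun x => by
    obtain ⟨s, hs, hx⟩ := hS x
    exact ⟨⟨s, hs⟩, hx⟩
  choose p hp using hp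
  obtain ⟨H, hH, h | h⟩ := hκ.exists_homogeneous fun x y => p x = p y
  · have hne : H.Nonempty := by
      rw [← Set.nonempty_coe_sort, ← mk_ne_zero_iff, hH]
      exact (aleph0_pos.trans_le h0).ne'
    obtain ⟨a, ha⟩ := hne
    have hsub : H ⊆ Iic (p a : Pt κ) := by
      intro x hx
      rcases lt_trichotomy a x with hax | rfl | hax
      · exact (hp x).trans (by rw [h a ha x hx hax])
      · exact hp _
      · exact (hp x).trans (by rw [h x hx a ha hax])
    exact ((mk_le_mk_of_subset hsub).trans_lt (mk_Iic_pt_lt h0 _)).ne hH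
  · have hinj : Function.Injective fun x : H => p x := by
      intro x y hxy
      by_contra hne
      rcases lt_or_gt_of_ne (fun e => hne (Subtype.ext e) : (x : Pt κ) ≠ y) with hl | hl
      · exact h _ x.2 _ y.2 hl hxy
      · exact h _ y.2 _ x.2 hl hxy.symm
    exact ((mk_le_of_injective hinj).trans_lt hlt).ne hH

/-- There is no lexicographically increasing `κ`-sequence of functions on a well-order of size
less than `κ`. -/
theorem not_lex_increasing (hκ : κ.IsRegular) {Λ : Type u} [LinearOrder Λ] [WellFoundedLT Λ]
    (hΛ : #Λ < κ) (i : Pt κ → Λ → Prop) (γ : WithTop Λ) :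
    ∀ H : Set (Pt κ), #H = κ →
      ¬ ∀ x ∈ H, ∀ y ∈ H, x < y →
        ∃ ξ : Λ, (ξ : WithTop Λ) < γ ∧ (∀ η < ξ, i x η ↔ i y η) ∧ ¬ i x ξ ∧ i y ξ := by
  induction γ using WellFoundedLT.induction with
  | ind γ ih =>
  intro H hH hinc
  have hnext : ∀ x : H, ∃ y : H, x < y ∧ ∀ z : H, x < z → y ≤ z := by
    intro x
    have hne : (Ioi x).Nonempty := by
      by_contra hemp
      have hsub : H ⊆ Iic (x : Pt κ) := by
        intro y hy
        by_contra hlt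
        exact hemp ⟨⟨y, hy⟩, show (x : Pt κ) < y from not_le.1 hlt⟩
      exact ((mk_le_mk_of_subset hsub).trans_lt (mk_Iic_pt_lt hκ.aleph0_le _)).ne hH
    refine ⟨wellFounded_lt.min _ hne, wellFounded_lt.min_mem _ hne, fun z hz => ?_⟩
    exact not_lt.1 (WellFounded.not_lt_min wellFounded_lt (Ioi x) hz)
  choose nx hnx hnx' using hnext
  have hd : ∀ x : H, ∃ ξ : Λ, (ξ : WithTop Λ) < γ ∧
      (∀ η < ξ, i x η ↔ i (nx x) η) ∧ ¬ i x ξ ∧ i (nx x) ξ :=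
    fun x => hinc _ x.2 _ (nx x).2 (hnx x)
  choose d hd1 hd2 hd3 hd4 using hd
  -- There are fewer than κ places and κ is regular, so κ many elements share the place ξ where they
  -- first differ from their successor in `H`. On these elements the bound on first differences
  -- drops from γ to ξ, which drives the induction.
  obtain ⟨ξ, hξ⟩ := infinite_pigeonhole d (by rw [hH]; exact hκ.aleph0_le)
    (by rw [hH, hκ.cof_ord]; exact hΛ)
  have hne : (d ⁻¹' {ξ}).Nonempty := by
    rw [← Set.nonempty_coe_sort, ← mk_ne_zero_iff, hξ, hH]
    exact hκ.ne_zero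
  obtain ⟨x0, hx0⟩ := hne
  have hx0' : d x0 = ξ := hx0
  refine ih ξ (hx0' ▸ hd1 x0) (Subtype.val '' (d ⁻¹' {ξ})) ?_ ?_
  · rw [mk_image_eq Subtype.val_injective, hξ, hH]
  rintro _ ⟨x, hx, rfl⟩ _ ⟨y, hy, rfl⟩ hxy
  have hx' : d x = ξ := hx
  have hy' : d y = ξ := hy
  obtain ⟨ζ, -, h2, h3, h4⟩ := hinc _ x.2 _ y.2 hxy
  refine ⟨ζ, ?_, h2, h3, h4⟩
  -- Both `x` and `y` are false at ξ, while the successor of `x` is true there. If `x` and `y`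
  -- agreed up to and including ξ, the successor of `x`, which agrees with `x` below ξ, could not
  -- precede `y` lexicographically.
  rw [WithTop.coe_lt_coe]
  by_contra! hle
  have hxn : ¬ i x ξ := hx' ▸ hd3 x
  have hyn : ¬ i y ξ := hy' ▸ hd3 y
  have hxs : i (nx x) ξ := hx' ▸ hd4 x
  rcases hle.eq_or_lt with rfl | hlt
  · exact hyn h4
  · rcases (hnx' x y hxy).eq_or_lt with he | hl
    · exact hyn (he ▸ hxs)
    · obtain ⟨θ, -, k2, k3, k4⟩ := hinc _ (nx x).2 _ y.2 hl
      have hθ : θ < ξ := by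
        by_contra! hle
        rcases hle.eq_or_lt with rfl | hlt
        · exact k3 hxs
        · exact hyn ((k2 ξ hlt).1 hxs)
      have hθx : ¬ i x θ := fun h => k3 ((hd2 x θ (hx'.symm ▸ hθ)).1 h)
      exact hθx ((h2 θ (hθ.trans hlt)).2 k4)

/-- Sierpiński's colouring: if κ embedded into 2^λ with λ < κ, colouring pairs by whether the
well-order agrees with the lexicographic order would yield a monotone κ-sequence in 2^λ. -/
theorem IsWeaklyCompact.isStrongPrelimit (hκ : IsWeaklyCompact κ) : κ.IsStrongPrelimit := by
  intro lam hlam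
  by_contra! hle
  have hreg := hκ.isRegular
  obtain ⟨Λ, rfl⟩ : ∃ Λ : Ordinal.{u}, #Λ.ToType = lam := ⟨lam.ord, by simp⟩
  have hemb : #(Pt κ) ≤ #(Λ.ToType → Prop) := by
    rw [mk_ord_toType]
    simpa using hle
  obtain ⟨i⟩ := hemb
  have hΛ : Nonempty Λ.ToType := by
    by_contra hemp
    rw [not_nonempty_iff] at hemp
    have := hκ.1.trans_le hle
    rw [mk_eq_zero, power_zero] at this
    exact absurd this (not_lt.2 one_lt_aleph0.le)
  have hdiff : ∀ x y, ∃ ξ, x < y → (∀ η < ξ, i x η ↔ i y η) ∧ ¬ (i x ξ ↔ i y ξ) := by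
    intro x y
    by_cases hxy : x < y
    swap
    · exact ⟨Classical.choice hΛ, fun h => absurd h hxy⟩
    have hne : {ξ | ¬ (i x ξ ↔ i y ξ)}.Nonempty := by
      by_contra hemp
      refine hxy.ne (i.injective (funext fun ξ => propext ?_))
      by_contra h
      exact hemp ⟨ξ, h⟩
    refine ⟨wellFounded_lt.min _ hne, fun _ => ⟨fun η hη => ?_, wellFounded_lt.min_mem _ hne⟩⟩
    by_contra h
    exact WellFounded.not_lt_min wellFounded_lt _ h hη
  choose d hd using hdiff
  obtain ⟨H, hH, h | h⟩ := hκ.exists_homogeneous fun x y => i y (d x y)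
  · refine not_lex_increasing hreg hlam i ⊤ H hH fun x hx y hy hxy => ?_
    have h1 := h x hx y hy hxy
    refine ⟨d x y, WithTop.coe_lt_top _, (hd x y hxy).1, fun h2 => (hd x y hxy).2 ?_, h1⟩
    exact ⟨fun _ => h1, fun _ => h2⟩
  -- Complementing all the functions turns a lexicographically decreasing sequence into an
  -- increasing one.
  · refine not_lex_increasing hreg hlam (fun x ξ => ¬ i x ξ) ⊤ H hH fun x hx y hy hxy => ?_
    have h1 := h x hx y hy hxy
    refine ⟨d x y, WithTop.coe_lt_top _, fun η hη => not_congr ((hd x y hxy).1 η hη), fun h2 => ?_, h1⟩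
    exact (hd x y hxy).2 ⟨fun h3 => absurd h3 h2, fun h3 => absurd h3 h1⟩

theorem IsWeaklyCompact.isInaccessible (hκ : IsWeaklyCompact κ) : κ.IsInaccessible :=
  ⟨hκ.1, hκ.isRegular.2, hκ.isStrongPrelimit⟩

end WeaklyCompact

/-! ### Bounds below an inaccessible cardinal -/

section Inaccessible

variable {κ : Cardinal.{u}}

theorem exists_gt_of_mk_lt (hκ : κ.IsInaccessible) {S : Set (Pt κ)} (hS : #S < κ) :
    ∃ b, ∀ s ∈ S, s < b := by
  by_contra! h
  have := Order.cof_le (s := S) h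
  rw [Ordinal.cof_toType] at this
  exact absurd (hκ.le_cof_ord.trans this) (not_le.2 hS)

theorem exists_gt_range (hκ : κ.IsInaccessible) {ι : Type u} (hι : #ι < κ) (f : ι → Pt κ) :
    ∃ b, ∀ i, f i < b := by
  obtain ⟨b, hb⟩ := exists_gt_of_mk_lt hκ (mk_range_le.trans_lt hι : #(range f) < κ)
  exact ⟨b, fun i => hb _ ⟨i, rfl⟩⟩

theorem exists_gt_countable (hκ : κ.IsInaccessible) {ι : Type*} [Countable ι] (f : ι → Pt κ) :
    ∃ b, ∀ i, f i < b := by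
  obtain ⟨b, hb⟩ := exists_gt_of_mk_lt hκ
    ((countable_range f).le_aleph0.trans_lt hκ.aleph0_lt : #(range f) < κ)
  exact ⟨b, fun i => hb _ ⟨i, rfl⟩⟩

theorem exists_pt_gt (hκ : κ.IsInaccessible) (a : Pt κ) : ∃ b, a < b :=
  (exists_gt_countable hκ fun _ : Unit => a).imp fun _ h => h ()

/-- This is κ^{<κ} = κ: a function is identified with its graph, a subset of κ × κ of size less than
κ, and a regular strong limit has only κ such subsets. -/
theorem mk_fun_le (hκ : κ.IsInaccessible) {I : Type u} (hI : #I < κ) {A : Type u} (hA : #A ≤ κ) :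
    #(I → A) ≤ κ := by
  have hK : #(Pt κ × Pt κ) = κ := by simp [mul_eq_self hκ.aleph0_lt.le]
  obtain ⟨e⟩ : #I ≤ #(Pt κ) := by simpa using hI.le
  obtain ⟨e'⟩ : #A ≤ #(Pt κ) := by simpa using hA
  have hs := mk_subset_mk_lt_cof (α := Pt κ × Pt κ) (by rw [hK]; exact hκ.isStrongPrelimit)
  rw [hK, hκ.isRegular.cof_ord] at hs
  rw [← hs]
  refine mk_le_of_injective (f := fun f : I → A => ⟨range fun i => (e i, e' (f i)),
    mk_range_le.trans_lt hI⟩) fun f g h => ?_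
  have h' : (range fun i => (e i, e' (f i))) = range fun i => (e i, e' (g i)) :=
    congrArg Subtype.val h
  funext i
  have hi : (e i, e' (f i)) ∈ range fun i => (e i, e' (g i)) := by
    rw [← h']
    exact ⟨i, rfl⟩
  obtain ⟨j, hj⟩ := hi
  obtain ⟨h1, h2⟩ := Prod.mk.inj hj
  rw [e.injective h1] at h2
  exact (e'.injective h2).symm

theorem mk_union_lt (hκ : κ.IsInaccessible) {α : Type u} {s t : Set α} (hs : #s < κ) (ht : #t < κ) :
    #(s ∪ t : Set α) < κ :=
  (mk_union_le s t).trans_lt (add_lt_of_lt hκ.aleph0_lt.le hs ht)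

end Inaccessible

/-! ### Open sets in the bounded topology -/

section BoundedTopology

variable {κ : Cardinal.{u}}

theorem isOpen_bSpace_iff (h : ℵ₀ ≤ κ) {I : Type u} {A : Type v} {O : Set (BSpace κ I A)} :
    IsOpen O ↔ ∀ x ∈ O, ∃ d : Set I, #d < κ ∧ ∀ y : BSpace κ I A, (∀ i ∈ d, y i = x i) → y ∈ O := by
  constructor
  · intro hO
    induction hO with
    | basic s hs =>
      obtain ⟨d, t, hd, rfl⟩ := hs
      exact fun x hx => ⟨d, hd, fun y hy i hi => (hy i hi).trans (hx i hi)⟩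
    | univ => exact fun x _ => ⟨∅, by simpa using aleph0_pos.trans_le h, fun y _ => mem_univ y⟩
    | inter s t _ _ hs ht =>
      rintro x ⟨hxs, hxt⟩
      obtain ⟨d, hd, h1⟩ := hs x hxs
      obtain ⟨e, he, h2⟩ := ht x hxt
      refine ⟨d ∪ e, (mk_union_le d e).trans_lt (add_lt_of_lt h hd he), fun y hy => ⟨?_, ?_⟩⟩
      · exact h1 y fun i hi => hy i (Or.inl hi)
      · exact h2 y fun i hi => hy i (Or.inr hi)
    | sUnion S _ hS =>
      rintro x ⟨s, hs, hx⟩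
      obtain ⟨d, hd, h1⟩ := hS s hs x hx
      exact ⟨d, hd, fun y hy => ⟨s, hs, h1 y hy⟩⟩
  · intro hO
    rw [isOpen_iff_mem_nhds]
    intro x hx
    obtain ⟨d, hd, h1⟩ := hO x hx
    have hN : IsOpen {y : BSpace κ I A | ∀ i ∈ d, y i = x i} :=
      isOpen_generateFrom_of_mem ⟨d, x, hd, rfl⟩
    exact Filter.mem_of_superset (hN.mem_nhds fun i _ => rfl) h1

theorem isClosed_bSpace_iff (h : ℵ₀ ≤ κ) {I : Type u} {A : Type v} {C : Set (BSpace κ I A)} :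
    IsClosed C ↔
      ∀ x ∉ C, ∃ d : Set I, #d < κ ∧ ∀ y : BSpace κ I A, (∀ i ∈ d, y i = x i) → y ∉ C := by
  rw [← isOpen_compl_iff, isOpen_bSpace_iff h]
  rfl

/-- The set of points of the generalized Baire space agreeing with `x` below `α`. -/
def ball (x : Baire κ) (α : Pt κ) : Set (Baire κ) := {y | ∀ β < α, y β = x β}

theorem isOpen_baire_iff (hκ : κ.IsInaccessible) {O : Set (Baire κ)} :
    IsOpen O ↔ ∀ x ∈ O, ∃ α, ball x α ⊆ O := by
  rw [isOpen_bSpace_iff hκ.aleph0_lt.le]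
  refine forall₂_congr fun x _ => ⟨?_, ?_⟩
  · rintro ⟨d, hd, h⟩
    obtain ⟨α, hα⟩ := exists_gt_of_mk_lt hκ hd
    exact ⟨α, fun y hy => h y fun i hi => hy i (hα i hi)⟩
  · rintro ⟨α, h⟩
    exact ⟨Iio α, mk_Iio_pt_lt α, fun y hy => h hy⟩

/-- A map into a space of functions is continuous if each of its coordinates depends on
finitely many coordinates of the argument. -/
theorem continuous_bSpace_of_coord (h : ℵ₀ ≤ κ) {I J : Type u} {A B : Type*}
    (f : BSpace κ I A → BSpace κ J B) (D : J → Set I) (hD : ∀ j, (D j).Finite)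
    (hf : ∀ x y j, (∀ i ∈ D j, x i = y i) → f x j = f y j) : Continuous f := by
  refine continuous_def.2 fun O hO => ?_
  rw [isOpen_bSpace_iff h] at hO ⊢
  intro x hx
  obtain ⟨d, hd, hd'⟩ := hO _ hx
  refine ⟨⋃ j : d, D j, ?_, fun y hy => hd' _ fun j hj => hf _ _ _ fun i hi => ?_⟩
  · refine (mk_iUnion_le _).trans_lt ?_
    -- Regularity is not available here: for κ = ℵ₀ the union is finite, and for larger κ its size
    -- is at most #d · ℵ₀.
    rcases h.eq_or_lt with rfl | hlt
    · have : Finite d := lt_aleph0_iff_finite.1 hd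
      have := (finite_iUnion fun j : d => hD j).lt_aleph0
      refine mul_lt_of_lt le_rfl hd ?_
      rcases isEmpty_or_nonempty d with hem | hne
      · simp [aleph0_pos]
      · obtain ⟨j, hj⟩ := exists_eq_ciSup_of_finite (f := fun j : d => #(D j))
        rw [← hj]
        exact (hD j).lt_aleph0
    · refine mul_lt_of_lt h hd (lt_of_le_of_lt (ciSup_le' fun j => ?_) hlt)
      exact (hD j).lt_aleph0.le
  · exact hy i (mem_iUnion.2 ⟨⟨j, hj⟩, hi⟩)

end BoundedTopology

/-! ### Ladders and stationary sets -/

section Ladders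

variable {κ : Cardinal.{u}}

/-- `f` is a strictly increasing sequence with supremum `δ`. -/
def IsLadder (δ : Pt κ) (f : ℕ → Pt κ) : Prop :=
  StrictMono f ∧ (∀ n, f n < δ) ∧ ∀ β < δ, ∃ n, β < f n

/-- `δ` is closed under `F`. -/
def IsClosedUnder (F : Pt κ → Pt κ) (δ : Pt κ) : Prop := ∀ β < δ, F β < δ

/-- Iterate a function dominating `F` on initial segments ω times from `b`; the iterates are a
ladder, and their supremum is the required point. -/
theorem exists_closure_point (hκ : κ.IsInaccessible) (F : Pt κ → Pt κ) (b : Pt κ) :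
    ∃ δ, b < δ ∧ IsClosedUnder F δ ∧ ∃ f, IsLadder δ f := by
  have hstep : ∀ a : Pt κ, ∃ a', a < a' ∧ ∀ β ≤ a, F β < a' := by
    intro a
    obtain ⟨a', ha'⟩ := exists_gt_range hκ (mk_Iic_pt_lt hκ.aleph0_lt.le a) fun β : Iic a => F β
    exact ⟨max a' (Classical.choose (exists_pt_gt hκ a)),
      lt_max_of_lt_right (Classical.choose_spec (exists_pt_gt hκ a)),
      fun β hβ => lt_max_of_lt_left (ha' ⟨β, hβ⟩)⟩
  choose g hg hg' using hstep
  let f : ℕ → Pt κ := fun n => g^[n] b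
  have hf : ∀ n, f (n + 1) = g (f n) := fun n => Function.iterate_succ_apply' g n b
  have hmono : StrictMono f := strictMono_nat_of_lt_succ fun n => by rw [hf]; exact hg _
  have hne : {δ | ∀ n, f n < δ}.Nonempty := exists_gt_countable hκ f
  let δ := wellFounded_lt.min _ hne
  have hδ : ∀ n, f n < δ := wellFounded_lt.min_mem _ hne
  have hsup : ∀ β < δ, ∃ n, β < f n := by
    intro β hβ
    by_contra! h
    refine WellFounded.not_lt_min wellFounded_lt _ (x := β) (fun n => ?_) hβ
    exact (hmono n.lt_succ_self).trans_le (h _)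
  refine ⟨δ, hδ 0, fun β hβ => ?_, f, hmono, hδ, hsup⟩
  obtain ⟨n, hn⟩ := hsup β hβ
  exact (hg' (f n) β hn.le).trans (hf n ▸ hδ (n + 1))

open Classical in
/-- A choice of a ladder at every point of countable cofinality. -/
noncomputable def lad (δ : Pt κ) : ℕ → Pt κ :=
  if h : ∃ f, IsLadder δ f then h.choose else fun _ => δ

theorem isLadder_lad {δ : Pt κ} (h : ∃ f, IsLadder δ f) : IsLadder δ (lad δ) := by
  rw [lad, dif_pos h]
  exact h.choose_spec

/-- There are unboundedly many `ρ` such that the set of `δ` of countable cofinality whose ladder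
takes the value `ρ` at a fixed place is stationary. -/
theorem exists_stationary_fibres (hκ : κ.IsInaccessible) :
    ∃ n : ℕ, ∀ η : Pt κ, ∃ ρ, η ≤ ρ ∧ ∀ F : Pt κ → Pt κ,
      ∃ δ, IsLadder δ (lad δ) ∧ IsClosedUnder F δ ∧ lad δ n = ρ := by
  by_contra! h
  choose η hη using h
  have h' : ∀ n ρ, ∃ F : Pt κ → Pt κ, η n ≤ ρ →
      ∀ δ, IsLadder δ (lad δ) → IsClosedUnder F δ → lad δ n ≠ ρ := by
    intro n ρ
    by_cases hle : η n ≤ ρ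
    · obtain ⟨F, hF⟩ := hη n ρ hle
      exact ⟨F, fun _ => hF⟩
    · exact ⟨id, fun h => absurd h hle⟩
  choose F hF using h'
  -- Diagonal intersection: a point δ closed under `G` is closed under `F n ρ` for every n and every
  -- ρ < δ.
  have hG : ∀ β : Pt κ, ∃ γ, ∀ n, ∀ ρ ≤ β, ∀ β' ≤ β, F n ρ β' < γ := by
    intro β
    have h1 : ∀ n : ℕ, ∃ γ, ∀ p : Iic β × Iic β, F n p.1 p.2 < γ := fun n =>
      exists_gt_range hκ (by
        rw [mk_prod, lift_id]
        exact mul_lt_of_lt hκ.aleph0_lt.le (mk_Iic_pt_lt hκ.aleph0_lt.le β)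
          (mk_Iic_pt_lt hκ.aleph0_lt.le β)) _
    choose γ hγ using h1
    obtain ⟨γ', hγ'⟩ := exists_gt_countable hκ γ
    exact ⟨γ', fun n ρ hρ β' hβ' => (hγ n (⟨ρ, hρ⟩, ⟨β', hβ'⟩)).trans (hγ' n)⟩
  choose G hG using hG
  obtain ⟨b, hb⟩ := exists_gt_countable hκ η
  obtain ⟨δ, hbδ, hδ, hl⟩ := exists_closure_point hκ G b
  have hlad := isLadder_lad hl
  -- The ladder at δ exceeds all the bounds `η` at some place n, so its n-th rung is a value whose
  -- fibre was assumed to avoid points such as δ.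
  obtain ⟨n, hn⟩ := hlad.2.2 b hbδ
  refine hF n (lad δ n) ((hb n).le.trans hn.le) δ hlad (fun β hβ => ?_) rfl
  have hmax : max β (lad δ n) < δ := max_lt hβ (hlad.2.1 n)
  exact (hG (max β (lad δ n)) n _ (le_max_right _ _) _ (le_max_left _ _)).trans (hδ _ hmax)

end Ladders

/-! ### Truncated functions and nodes -/

section Nodes

variable {κ : Cardinal.{u}}

/-- The functions from `κ` to `κ`, without a topology. -/
abbrev Fn (κ : Cardinal.{u}) : Type u := Pt κ → Pt κ

open Classical in
/-- The function that agrees with `f` below `α` and is constant from `α` on; it stands for the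
restriction of `f` to `α`. -/
noncomputable def trunc (α : Pt κ) (f : Fn κ) : Fn κ := fun β => if β < α then f β else α

theorem trunc_of_lt {α β : Pt κ} (h : β < α) (f : Fn κ) : trunc α f β = f β := if_pos h

theorem trunc_of_le {α β : Pt κ} (h : α ≤ β) (f : Fn κ) : trunc α f β = α := if_neg h.not_gt

theorem trunc_trunc {α β : Pt κ} (h : β ≤ α) (f : Fn κ) : trunc β (trunc α f) = trunc β f := by
  funext γ
  rcases lt_or_ge γ β with hγ | hγ
  · rw [trunc_of_lt hγ, trunc_of_lt hγ, trunc_of_lt (hγ.trans_le h)]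
  · rw [trunc_of_le hγ, trunc_of_le hγ]

theorem trunc_eq_trunc_iff {α : Pt κ} {f g : Fn κ} :
    trunc α f = trunc α g ↔ ∀ β < α, f β = g β := by
  refine ⟨fun h β hβ => ?_, fun h => funext fun β => ?_⟩
  · rw [← trunc_of_lt hβ f, h, trunc_of_lt hβ]
  · rcases lt_or_ge β α with hβ | hβ
    · rw [trunc_of_lt hβ, trunc_of_lt hβ, h β hβ]
    · rw [trunc_of_le hβ, trunc_of_le hβ]

theorem eq_of_forall_trunc_eq (hκ : κ.IsInaccessible) {f g : Fn κ}
    (h : ∀ α, trunc α f = trunc α g) : f = g := by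
  funext β
  obtain ⟨α, hα⟩ := exists_pt_gt hκ β
  exact trunc_eq_trunc_iff.1 (h α) β hα

theorem exists_of_coherent (hκ : κ.IsInaccessible) (F : Pt κ → Fn κ)
    (hF : ∀ α β, β ≤ α → trunc β (F α) = F β) : ∃ f, ∀ α, F α = trunc α f := by
  choose s hs using exists_pt_gt hκ
  refine ⟨fun γ => F (s γ) γ, fun α => ?_⟩
  rw [← hF α α le_rfl, trunc_eq_trunc_iff]
  intro γ hγ
  rcases le_total α (s γ) with h | h
  · rw [← hF _ _ h, trunc_of_lt hγ]
  · rw [← hF _ _ h, trunc_of_lt (hs γ)]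

/-- Truncation of pairs of functions. -/
noncomputable def truncPair (α : Pt κ) (p : Fn κ × Fn κ) : Fn κ × Fn κ :=
  (trunc α p.1, trunc α p.2)

theorem truncPair_truncPair {α β : Pt κ} (h : β ≤ α) (p : Fn κ × Fn κ) :
    truncPair β (truncPair α p) = truncPair β p := by
  simp [truncPair, trunc_trunc h]

theorem map_truncPair {α β : Pt κ} (h : β ≤ α) (L : List (Fn κ × Fn κ)) :
    (L.map (truncPair α)).map (truncPair β) = L.map (truncPair β) := by
  rw [List.map_map]
  exact List.map_congr_left fun p _ => truncPair_truncPair h p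

/-- Finiteness of chains matters here: with one length at all levels, the entries can be glued one
position at a time. -/
theorem exists_list_of_coherent (hκ : κ.IsInaccessible) (n : ℕ)
    (F : Pt κ → List (Fn κ × Fn κ)) (hn : ∀ α, (F α).length = n)
    (hF : ∀ α β, β ≤ α → (F α).map (truncPair β) = F β) :
    ∃ L : List (Fn κ × Fn κ), ∀ α, F α = L.map (truncPair α) := by
  induction n generalizing F with
  | zero => exact ⟨[], fun α => List.length_eq_zero_iff.1 (hn α)⟩
  | succ n ih =>
    have h : ∀ α, ∃ p M, F α = p :: M := fun α => List.exists_cons_of_length_eq_add_one (hn α)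
    choose p M hpM using h
    have hc : ∀ α β, β ≤ α → truncPair β (p α) = p β ∧ (M α).map (truncPair β) = M β := by
      intro α β hβ
      have := hF α β hβ
      rwa [hpM, hpM, List.map_cons, List.cons.injEq] at this
    obtain ⟨L, hL⟩ := ih M (fun α => by have := hn α; rw [hpM] at this; simpa using this)
      fun α β hβ => (hc α β hβ).2
    obtain ⟨f, hf⟩ := exists_of_coherent hκ (fun α => (p α).1)
      fun α β hβ => congrArg Prod.fst (hc α β hβ).1
    obtain ⟨g, hg⟩ := exists_of_coherent hκ (fun α => (p α).2)
      fun α β hβ => congrArg Prod.snd (hc α β hβ).1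
    refine ⟨(f, g) :: L, fun α => ?_⟩
    rw [hpM, List.map_cons, hL]
    congr 1
    exact Prod.ext (hf α) (hg α)

/-- A node of level `lev`: the restrictions to `lev` of a function `start` and of a finite list
of pairs of functions. -/
@[ext]
structure Node (κ : Cardinal.{u}) : Type u where
  lev : Pt κ
  start : Fn κ
  chain : List (Fn κ × Fn κ)
  trunc_start : trunc lev start = start
  map_chain : chain.map (truncPair lev) = chain

/-- The node of level `α` obtained by truncating the given data. -/
noncomputable def Node.of (α : Pt κ) (f : Fn κ) (L : List (Fn κ × Fn κ)) : Node κ where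
  lev := α
  start := trunc α f
  chain := L.map (truncPair α)
  trunc_start := trunc_trunc le_rfl f
  map_chain := map_truncPair le_rfl L

noncomputable def Node.restrict (s : Node κ) (β : Pt κ) : Node κ := Node.of β s.start s.chain

/-- `t` is a proper restriction of `s`. -/
def Node.Below (t s : Node κ) : Prop := t.lev < s.lev ∧ t = s.restrict t.lev

/-- Nodes form a tree: the nodes below a given one are linearly ordered by level. -/
theorem Node.Below.below_of_lev_lt {s t t' : Node κ} (h : t.Below s) (h' : t'.Below s)
    (hlt : t.lev < t'.lev) : t.Below t' := by
  refine ⟨hlt, ?_⟩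
  have h1 := h.2
  have h2 := h'.2
  ext1
  · rfl
  · rw [h2, h1]
    exact (trunc_trunc hlt.le _).symm
  · rw [h2, h1]
    exact (map_truncPair hlt.le _).symm

/-- Adding a pair to the chain of a node. -/
noncomputable def Node.cons (s : Node κ) (p : Fn κ × Fn κ) : Node κ where
  lev := s.lev
  start := s.start
  chain := truncPair s.lev p :: s.chain
  trunc_start := s.trunc_start
  map_chain := by rw [List.map_cons, s.map_chain, truncPair_truncPair le_rfl]

theorem Node.cons_injective (p : Fn κ × Fn κ) : Function.Injective fun s : Node κ => s.cons p := by
  intro s t (h : s.cons p = t.cons p)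
  have h1 : s.lev = t.lev := congrArg (a₁ := s.cons p) (a₂ := t.cons p) Node.lev h
  have h2 : s.start = t.start := congrArg (a₁ := s.cons p) (a₂ := t.cons p) Node.start h
  have h3 : truncPair s.lev p :: s.chain = truncPair t.lev p :: t.chain := congrArg Node.chain h
  exact Node.ext h1 h2 (List.cons.inj h3).2

/-- The new entries are truncations of one fixed pair, hence automatically coherent between levels.
-/
theorem Node.cons_below_cons_iff {s t : Node κ} (p : Fn κ × Fn κ) :
    (t.cons p).Below (s.cons p) ↔ t.Below s := by
  refine and_congr_right fun hlt => ?_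
  have hlt' : t.lev < s.lev := hlt
  constructor
  · intro h
    have h2 : t.start = trunc t.lev s.start := congrArg Node.start h
    have h3 : truncPair t.lev p :: t.chain =
      (truncPair s.lev p :: s.chain).map (truncPair t.lev) := congrArg Node.chain h
    rw [List.map_cons] at h3
    exact Node.ext rfl h2 (List.cons.inj h3).2
  · intro h
    have h2 : t.start = trunc t.lev s.start := congrArg Node.start h
    have h3 : t.chain = s.chain.map (truncPair t.lev) := congrArg Node.chain h
    refine Node.ext rfl h2 ?_
    change truncPair t.lev p :: t.chain = (truncPair s.lev p :: s.chain).map (truncPair t.lev)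
    rw [List.map_cons, truncPair_truncPair hlt'.le, ← h3]

/-- A truncated function is determined by its level and its values below that level, so κ^{<κ} = κ
applies. -/
theorem mk_truncated_le (hκ : κ.IsInaccessible) :
    #{p : Pt κ × Fn κ // trunc p.1 p.2 = p.2} ≤ κ := by
  have h1 : #(Σ α : Pt κ, (Iio α → Pt κ)) ≤ κ := by
    rw [mk_sigma]
    calc (Cardinal.sum fun α : Pt κ => #(Iio α → Pt κ))
        ≤ Cardinal.sum fun _ : Pt κ => κ :=
          sum_le_sum _ _ fun α => mk_fun_le hκ (mk_Iio_pt_lt α) (mk_ord_toType κ).le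
      _ = κ := by simp [mul_eq_self hκ.aleph0_lt.le]
  refine le_trans ?_ h1
  refine mk_le_of_injective (f := fun p => ⟨p.1.1, fun β => p.1.2 β⟩) ?_
  rintro ⟨⟨α, f⟩, hf⟩ ⟨⟨α', f'⟩, hf'⟩ h
  obtain rfl : α = α' := congrArg Sigma.fst h
  have h2 : (fun β : Iio α => f β) = fun β : Iio α => f' β := eq_of_heq (Sigma.mk.inj h).2
  have h3 : trunc α f = trunc α f' := trunc_eq_trunc_iff.2 fun β hβ => congrFun h2 ⟨β, hβ⟩
  have h4 : f = f' := by
    have e1 : trunc α f = f := hf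
    have e2 : trunc α f' = f' := hf'
    rw [← e1, ← e2, h3]
  subst h4
  rfl

theorem mk_node_le (hκ : κ.IsInaccessible) : #(Node κ) ≤ κ := by
  let Q := {p : Pt κ × Fn κ // trunc p.1 p.2 = p.2}
  have hQ : #Q ≤ κ := mk_truncated_le hκ
  have h0 := hκ.aleph0_lt.le
  have hsurj : Function.Surjective fun q : Pt κ × Q × List (Q × Q) =>
      Node.of q.1 q.2.1.1.2 (q.2.2.map fun r => (r.1.1.2, r.2.1.2)) := by
    intro s
    refine ⟨(s.lev, ⟨(s.lev, s.start), s.trunc_start⟩, s.chain.map fun r =>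
      (⟨(s.lev, trunc s.lev r.1), trunc_trunc le_rfl _⟩,
        ⟨(s.lev, trunc s.lev r.2), trunc_trunc le_rfl _⟩)), ?_⟩
    refine Node.ext rfl s.trunc_start ?_
    change List.map _ (List.map _ (List.map _ s.chain)) = s.chain
    conv_rhs => rw [← s.map_chain]
    rw [List.map_map, List.map_map]
    exact List.map_congr_left fun p _ => truncPair_truncPair le_rfl p
  refine (mk_le_of_surjective hsurj).trans ?_
  have h2 : #(Q × Q) ≤ κ := by
    rw [mk_prod, lift_id]
    exact (mul_le_mul' hQ hQ).trans (mul_eq_self h0).le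
  have h3 : #(List (Q × Q)) ≤ κ := (mk_list_le_max _).trans (max_le h0 h2)
  rw [mk_prod, mk_prod, lift_id, lift_id, lift_id, lift_id, mk_ord_toType]
  calc κ * (#Q * #(List (Q × Q))) ≤ κ * (κ * κ) := by gcongr
    _ = κ := by rw [mul_eq_self h0, mul_eq_self h0]

end Nodes

/-! ### Chains -/

section Chains

variable {κ : Cardinal.{u}}

/-- The end point of a chain starting from `f`. The last step comes first in the list. -/
def endPoint (f : Fn κ) : List (Fn κ × Fn κ) → Fn κ
  | [] => f
  | p :: _ => p.2

/-- The list is a chain of `R`-steps from `f`; the first components of its members witness the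
steps, the second components are the points reached. -/
def IsChainFrom (R : Fn κ → Fn κ → Fn κ → Prop) (f : Fn κ) : List (Fn κ × Fn κ) → Prop
  | [] => True
  | p :: L => R (endPoint f L) p.2 p.1 ∧ IsChainFrom R f L

theorem endPoint_map_trunc (α : Pt κ) (f : Fn κ) (L : List (Fn κ × Fn κ)) :
    endPoint (trunc α f) (L.map (truncPair α)) = trunc α (endPoint f L) := by
  cases L <;> rfl

/-- The triple of restrictions to `α` extends to a triple in `D`. -/
def LevelRel (D : Fn κ → Fn κ → Fn κ → Prop) (α : Pt κ) (z w ξ : Fn κ) : Prop :=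
  ∃ z' w' ξ', D z' w' ξ' ∧ trunc α z' = trunc α z ∧ trunc α w' = trunc α w ∧
    trunc α ξ' = trunc α ξ

/-- Each step is a closed condition, so being a step at every level makes it a genuine `D`-step; the
approximating triples may vary with the level. -/
theorem IsChainFrom.of_forall_level {D : Fn κ → Fn κ → Fn κ → Prop}
    (hD : ∀ z w ξ, (∀ α, LevelRel D α z w ξ) → D z w ξ) {f : Fn κ} {L : List (Fn κ × Fn κ)}
    (h : ∀ α, IsChainFrom (LevelRel D α) (trunc α f) (L.map (truncPair α))) :
    IsChainFrom D f L := by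
  induction L with
  | nil => trivial
  | cons p L ih =>
    refine ⟨hD _ _ _ fun α => ?_, ih fun α => (h α).2⟩
    obtain ⟨z', w', ξ', h0, h1, h2, h3⟩ := (h α).1
    refine ⟨z', w', ξ', h0, ?_, ?_, ?_⟩
    · rw [h1, endPoint_map_trunc, trunc_trunc le_rfl]
    · rw [h2]
      exact trunc_trunc le_rfl _
    · rw [h3]
      exact trunc_trunc le_rfl _

theorem IsChainFrom.reflTransGen {D : Fn κ → Fn κ → Fn κ → Prop} {f : Fn κ}
    {L : List (Fn κ × Fn κ)} (h : IsChainFrom D f L) :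
    Relation.ReflTransGen (fun z w => ∃ ξ, D z w ξ) f (endPoint f L) := by
  induction L with
  | nil => exact Relation.ReflTransGen.refl
  | cons p L ih => exact (ih h.2).tail ⟨_, h.1⟩

/-- The node is a chain of `R`-steps (at its level) that ends in the restriction of `x`. -/
def Node.Valid (R : Pt κ → Fn κ → Fn κ → Fn κ → Prop) (x : Fn κ) (s : Node κ) : Prop :=
  IsChainFrom (R s.lev) s.start s.chain ∧ endPoint s.start s.chain = trunc s.lev x

theorem Node.Valid.cons {R : Pt κ → Fn κ → Fn κ → Fn κ → Prop} {x y ξ : Fn κ} {s : Node κ}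
    (hs : s.Valid R x) (h : R s.lev (trunc s.lev x) (trunc s.lev y) (trunc s.lev ξ)) :
    (s.cons (ξ, y)).Valid R y :=
  ⟨⟨by rw [← hs.2] at h; exact h, hs.1⟩, rfl⟩

theorem Node.valid_of (R : Pt κ → Fn κ → Fn κ → Fn κ → Prop) (x : Fn κ) (α : Pt κ) :
    (Node.of α x []).Valid R x :=
  ⟨trivial, rfl⟩

end Chains

/-! ### The graph attached to a function -/

section Graph

variable {κ : Cardinal.{u}}

/-- The vertices of the graphs: two copies of `κ` for the points of the ladders, two copies of `κ`
for their tops, one copy for the labels, and countably many copies of the set of nodes. -/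
inductive Vtx (κ : Cardinal.{u}) : Type u
  | pt (β : Pt κ) (i : Bool)
  | top (δ : Pt κ) (i : Bool)
  | lab (ρ : Pt κ)
  | node (k : ℕ) (s : Node κ)

variable (R : Pt κ → Fn κ → Fn κ → Fn κ → Prop) (c : Node κ → Pt κ) (n₀ : ℕ)

/-- The edges of the graph attached to `x`, with an orientation. -/
inductive Edge (x : Fn κ) : Vtx κ → Vtx κ → Prop
  | pt_top (β δ : Pt κ) (i : Bool) (n : ℕ) : IsLadder δ (lad δ) → lad δ n = β →
      Edge x (.pt β i) (.top δ i)
  | top_lab (δ ρ : Pt κ) (i : Bool) : IsLadder δ (lad δ) → lad δ n₀ = ρ →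
      Edge x (.top δ i) (.lab ρ)
  | lab_node (ρ : Pt κ) (s : Node κ) : s.Valid R x → c s = ρ → Edge x (.lab ρ) (.node 0 s)
  | node_node (t s : Node κ) : t.Valid R x → s.Valid R x → t.Below s →
      Edge x (.node 0 t) (.node 0 s)

/-- The graph attached to `x`. -/
def vtxGraph (x : Fn κ) : SimpleGraph (Vtx κ) where
  Adj v w := Edge R c n₀ x v w ∨ Edge R c n₀ x w v
  symm := ⟨fun _ _ h => h.symm⟩
  loopless := ⟨fun v h => by
    have h : Edge R c n₀ x v v := h.elim id id
    cases h with
    | node_node _ _ _ _ h => exact lt_irrefl _ h.1⟩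

variable {R c n₀}

/-! #### Reductions yield embeddings -/

open Classical in
/-- The embedding of the graph of `x` into the graph of `y` given by a witness `ξ`. -/
noncomputable def vtxMap (R : Pt κ → Fn κ → Fn κ → Fn κ → Prop) (x y ξ : Fn κ) : Vtx κ → Vtx κ
  | .node 0 s => if s.Valid R x then .node 0 (s.cons (ξ, y)) else .node 1 s
  | .node (k + 1) s => .node (k + 2) s
  | v => v

theorem vtxMap_valid {x y ξ : Fn κ} {s : Node κ} (h : s.Valid R x) :
    vtxMap R x y ξ (.node 0 s) = .node 0 (s.cons (ξ, y)) := if_pos h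

theorem vtxMap_eq_pt {x y ξ : Fn κ} {v : Vtx κ} {β i} (h : vtxMap R x y ξ v = .pt β i) :
    v = .pt β i := by
  rcases v with _ | _ | _ | ⟨_ | k, s⟩
  · exact h
  · cases h
  · cases h
  · simp only [vtxMap] at h
    split_ifs at h
  · cases h

theorem vtxMap_eq_top {x y ξ : Fn κ} {v : Vtx κ} {δ i} (h : vtxMap R x y ξ v = .top δ i) :
    v = .top δ i := by
  rcases v with _ | _ | _ | ⟨_ | k, s⟩
  · cases h
  · exact h
  · cases h
  · simp only [vtxMap] at h
    split_ifs at h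
  · cases h

theorem vtxMap_eq_lab {x y ξ : Fn κ} {v : Vtx κ} {ρ} (h : vtxMap R x y ξ v = .lab ρ) :
    v = .lab ρ := by
  rcases v with _ | _ | _ | ⟨_ | k, s⟩
  · cases h
  · cases h
  · exact h
  · simp only [vtxMap] at h
    split_ifs at h
  · cases h

theorem vtxMap_eq_node_zero {x y ξ : Fn κ} {v : Vtx κ} {s} (h : vtxMap R x y ξ v = .node 0 s) :
    ∃ t : Node κ, v = .node 0 t ∧ t.Valid R x ∧ s = t.cons (ξ, y) := by
  rcases v with _ | _ | _ | ⟨_ | k, t⟩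
  · cases h
  · cases h
  · cases h
  · simp only [vtxMap] at h
    split_ifs at h with hv
    · cases h
      exact ⟨t, rfl, hv, rfl⟩
    · cases h
  · cases h

/-- Hilbert's hotel: an invalid node might coincide with the extension of a valid one, so invalid
nodes move to copy 1 and copy k + 1 moves to copy k + 2. All vertices moved in this way, and their
images, are isolated. -/
theorem vtxMap_injective (x y ξ : Fn κ) : Function.Injective (vtxMap R x y ξ) := by
  intro v w h
  rcases v with _ | _ | _ | ⟨_ | k, s⟩
  · exact (vtxMap_eq_pt h.symm).symm
  · exact (vtxMap_eq_top h.symm).symm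
  · exact (vtxMap_eq_lab h.symm).symm
  · by_cases hv : s.Valid R x
    · rw [vtxMap_valid hv] at h
      obtain ⟨t, rfl, -, ht⟩ := vtxMap_eq_node_zero h.symm
      rw [Node.cons_injective _ ht]
    · rcases w with _ | _ | _ | ⟨_ | l, t⟩ <;> simp only [vtxMap, if_neg hv] at h
      any_goals cases h
      split_ifs at h
      · cases h
      · cases h
        rfl
  · rcases w with _ | _ | _ | ⟨_ | l, t⟩ <;> simp only [vtxMap] at h
    any_goals cases h
    · split_ifs at h
      · cases h
      · cases h
    · rfl

/-- The code `c` ignores chains, so labels are unaffected by the appended step. In the other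
direction, a vertex of copy 0 in the image comes from a valid node. -/
theorem edge_vtxMap_iff (hc : ∀ s t : Node κ, c s = c t ↔ s.lev = t.lev ∧ s.start = t.start)
    {x y ξ : Fn κ} (h : ∀ α, R α (trunc α x) (trunc α y) (trunc α ξ)) (v w : Vtx κ) :
    Edge R c n₀ y (vtxMap R x y ξ v) (vtxMap R x y ξ w) ↔ Edge R c n₀ x v w := by
  have hcons : ∀ s : Node κ, c (s.cons (ξ, y)) = c s := fun s => (hc _ _).2 ⟨rfl, rfl⟩
  constructor
  · intro he
    generalize hv : vtxMap R x y ξ v = v' at he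
    generalize hw : vtxMap R x y ξ w = w' at he
    cases he with
    | pt_top β δ i n hl hn =>
      rw [vtxMap_eq_pt hv, vtxMap_eq_top hw]
      exact .pt_top β δ i n hl hn
    | top_lab δ ρ i hl hn =>
      rw [vtxMap_eq_top hv, vtxMap_eq_lab hw]
      exact .top_lab δ ρ i hl hn
    | lab_node ρ s hs hn =>
      obtain ⟨t, rfl, ht, rfl⟩ := vtxMap_eq_node_zero hw
      rw [vtxMap_eq_lab hv]
      exact .lab_node ρ t ht ((hcons t).symm.trans hn)
    | node_node t s ht hs hb =>
      obtain ⟨s, rfl, hs', rfl⟩ := vtxMap_eq_node_zero hw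
      obtain ⟨t, rfl, ht', rfl⟩ := vtxMap_eq_node_zero hv
      exact .node_node t s ht' hs' ((Node.cons_below_cons_iff _).1 hb)
  · intro he
    cases he with
    | pt_top β δ i n hl hn => exact .pt_top β δ i n hl hn
    | top_lab δ ρ i hl hn => exact .top_lab δ ρ i hl hn
    | lab_node ρ s hs hn =>
      rw [vtxMap_valid hs]
      exact .lab_node ρ _ (hs.cons (h s.lev)) ((hcons s).trans hn)
    | node_node t s ht hs hb =>
      rw [vtxMap_valid hs, vtxMap_valid ht]
      exact .node_node _ _ (ht.cons (h t.lev)) (hs.cons (h s.lev))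
        ((Node.cons_below_cons_iff _).2 hb)

/-- The embedding of graphs given by a witness. -/
noncomputable def vtxEmbedding
    (hc : ∀ s t : Node κ, c s = c t ↔ s.lev = t.lev ∧ s.start = t.start)
    {x y ξ : Fn κ} (h : ∀ α, R α (trunc α x) (trunc α y) (trunc α ξ)) :
    vtxGraph R c n₀ x ↪g vtxGraph R c n₀ y where
  toFun := vtxMap R x y ξ
  inj' := vtxMap_injective x y ξ
  map_rel_iff' {v w} := or_congr (edge_vtxMap_iff hc h v w) (edge_vtxMap_iff hc h w v)

/-! #### The tops of ladders are fixed -/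

/-- An enumeration of the vertices, with small fibres. -/
def vtxRank (e : ℕ × Node κ → Pt κ) : Vtx κ → Pt κ
  | .pt β _ => β
  | .top δ _ => δ
  | .lab ρ => ρ
  | .node k s => e (k, s)

/-- The number of the copy a vertex belongs to. -/
def vtxTag : Vtx κ → ℕ
  | .pt _ i => cond i 0 1
  | .top _ i => cond i 2 3
  | .lab _ => 4
  | .node _ _ => 5

theorem vtxRank_vtxTag_injective {e : ℕ × Node κ → Pt κ} (he : Function.Injective e) :
    Function.Injective fun v : Vtx κ => (vtxRank e v, vtxTag v) := by
  intro v w h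
  replace h := Prod.mk.inj h
  rcases v with ⟨_, _ | _⟩ | ⟨_, _ | _⟩ | _ | ⟨k, s⟩ <;>
    rcases w with ⟨_, _ | _⟩ | ⟨_, _ | _⟩ | _ | ⟨l, t⟩ <;>
    simp_all [vtxRank, vtxTag]
  exact Prod.mk.inj (he h)

theorem mk_vtxRank_le_lt (hκ : κ.IsInaccessible) {e : ℕ × Node κ → Pt κ}
    (he : Function.Injective e) (β : Pt κ) : #{v : Vtx κ | vtxRank e v ≤ β} < κ := by
  have h : #{v : Vtx κ | vtxRank e v ≤ β} ≤ #(Iic β × ULift.{u} ℕ) := by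
    refine mk_le_of_injective (f := fun v => (⟨vtxRank e v, v.2⟩, ⟨vtxTag v.1⟩)) ?_
    intro v w h
    obtain ⟨h1, h2⟩ := Prod.mk.inj h
    refine Subtype.ext (vtxRank_vtxTag_injective he ?_)
    exact Prod.ext (congrArg Subtype.val h1) (congrArg ULift.down h2)
  refine h.trans_lt ?_
  rw [mk_prod, lift_id, lift_id]
  refine mul_lt_of_lt hκ.aleph0_lt.le (mk_Iic_pt_lt hκ.aleph0_lt.le β) ?_
  simpa using hκ.aleph0_lt

theorem mk_vtx (hκ : κ.IsInaccessible) {e : ℕ × Node κ → Pt κ} (he : Function.Injective e) :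
    #(Vtx κ) = κ := by
  have h0 := hκ.aleph0_lt.le
  refine le_antisymm ?_ ?_
  · refine (mk_le_of_injective (β := Pt κ × ULift.{u} ℕ)
      (f := fun v : Vtx κ => (vtxRank e v, ⟨vtxTag v⟩)) ?_).trans ?_
    · intro v w h
      obtain ⟨h1, h2⟩ := Prod.mk.inj h
      exact vtxRank_vtxTag_injective he (Prod.ext h1 (congrArg ULift.down h2))
    · rw [mk_prod, lift_id, lift_id, mk_ord_toType]
      simpa using (mul_le_mul' le_rfl h0).trans (mul_eq_self h0).le
  · conv_lhs => rw [← mk_ord_toType κ]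
    exact mk_le_of_injective (f := Vtx.lab) fun _ _ h => Vtx.lab.inj h

/-- Closure points of a relation with small sections. -/
theorem exists_closure_of_rel (hκ : κ.IsInaccessible) {V : Type u} (rk : V → Pt κ)
    (hrk : ∀ β, #{v | rk v ≤ β} < κ) (Q : V → V → Prop) (hQ : ∀ v, #{w | Q v w} < κ) :
    ∃ F : Pt κ → Pt κ, ∀ δ, IsClosedUnder F δ → ∀ v w, Q v w → rk v < δ → rk w < δ := by
  have h : ∀ β : Pt κ, ∃ γ, ∀ v w, Q v w → rk v ≤ β → rk w < γ := by
    intro β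
    have hlt : #(⋃ v ∈ {v | rk v ≤ β}, {w | Q v w} : Set V) < κ :=
      (card_biUnion_lt_iff_forall_of_isRegular hκ.isRegular (hrk β)).2 fun v _ => hQ v
    obtain ⟨γ, hγ⟩ := exists_gt_of_mk_lt hκ (S := rk '' ⋃ v ∈ {v | rk v ≤ β}, {w | Q v w})
      (mk_image_le.trans_lt hlt)
    exact ⟨γ, fun v w hvw hv => hγ _ ⟨w, by simp only [mem_iUnion]; exact ⟨v, hv, hvw⟩, rfl⟩⟩
  choose F hF using h
  exact ⟨F, fun δ hδ v w hvw hv => (hF _ v w hvw le_rfl).trans (hδ _ hv)⟩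

/-- The dependencies between vertices that the ranks have to respect. -/
def VtxDep (c : Node κ → Pt κ) (g : Vtx κ → Vtx κ) (v w : Vtx κ) : Prop :=
  w = g v ∨ v = g w ∨ (∃ s, v = .node 0 s ∧ w = .lab (c s)) ∨
    ∃ t s : Node κ, v = .node 0 s ∧ w = .node 0 t ∧ t.Below s

/-- Injectivity of `g` leaves at most one preimage, and a node has at most one node below it at each
smaller level. -/
theorem mk_vtxDep_lt (hκ : κ.IsInaccessible) (c : Node κ → Pt κ) {g : Vtx κ → Vtx κ}
    (hg : Function.Injective g) (v : Vtx κ) : #{w | VtxDep c g v w} < κ := by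
  have hsub : ∀ S : Set (Vtx κ), S.Subsingleton → #S < κ := fun S hS =>
    hS.finite.lt_aleph0.trans hκ.aleph0_lt
  have h1 : #{w | w = g v} < κ := hsub _ fun a ha b hb => Eq.trans ha (Eq.symm hb)
  have h2 : #{w | v = g w} < κ := hsub _ fun a ha b hb => hg (ha.symm.trans hb)
  have h3 : #{w | ∃ s, v = Vtx.node 0 s ∧ w = Vtx.lab (c s)} < κ := hsub _ fun a ha b hb => by
    obtain ⟨s, hs, rfl⟩ := ha
    obtain ⟨t, ht, rfl⟩ := hb
    rw [hs] at ht
    cases ht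
    rfl
  have h4 : #{w | ∃ t s : Node κ, v = Vtx.node 0 s ∧ w = Vtx.node 0 t ∧ t.Below s} < κ := by
    by_cases hv : ∃ s, v = Vtx.node 0 s
    · obtain ⟨s, rfl⟩ := hv
      have hss : {w | ∃ t s' : Node κ, Vtx.node 0 s = Vtx.node 0 s' ∧ w = Vtx.node 0 t ∧ t.Below s'} ⊆
          (fun β => Vtx.node 0 (s.restrict β)) '' Iio s.lev := by
        rintro w ⟨t, s', hs, rfl, hb⟩
        cases hs
        exact ⟨t.lev, hb.1, congrArg _ hb.2.symm⟩
      exact (mk_le_mk_of_subset hss).trans_lt (mk_image_le.trans_lt (mk_Iio_pt_lt _))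
    · refine hsub _ ?_
      rintro a ⟨t, s, hs, -⟩
      exact absurd ⟨s, hs⟩ hv
  have := mk_union_lt hκ h1 (mk_union_lt hκ h2 (mk_union_lt hκ h3 h4))
  exact this

/-- When δ is closed under the dependencies, ladder points below δ keep rank below δ and a top over
δ keeps rank at least δ. The image of the top thus has infinitely many pairwise non-adjacent
neighbours of rank below δ, and every other kind of vertex is excluded. -/
theorem exists_map_top_eq (hκ : κ.IsInaccessible) {e : ℕ × Node κ → Pt κ}
    (he : Function.Injective e) {x y : Fn κ} (g : vtxGraph R c n₀ x ↪g vtxGraph R c n₀ y) :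
    ∃ F : Pt κ → Pt κ, ∀ δ, IsLadder δ (lad δ) → IsClosedUnder F δ →
      ∀ i, ∃ j, g (.top δ i) = .top δ j := by
  obtain ⟨F, hF⟩ := exists_closure_of_rel hκ (vtxRank e) (mk_vtxRank_le_lt hκ he) (VtxDep c g)
    (mk_vtxDep_lt hκ c g.injective)
  refine ⟨F, fun δ hl hδ i => ?_⟩
  specialize hF δ hδ
  have hge : δ ≤ vtxRank e (g (.top δ i)) := by
    by_contra! hlt
    exact lt_irrefl δ (hF _ (.top δ i) (Or.inr (Or.inl rfl)) hlt)
  have hrank : ∀ n, vtxRank e (g (.pt (lad δ n) i)) < δ := fun n =>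
    hF (.pt (lad δ n) i) _ (Or.inl rfl) (hl.2.1 n)
  have hadj : ∀ n, (vtxGraph R c n₀ y).Adj (g (.pt (lad δ n) i)) (g (.top δ i)) := fun n =>
    g.map_adj_iff.2 (Or.inl (.pt_top _ δ i n hl rfl))
  have hinj : Function.Injective fun n => g (.pt (lad δ n) i) := by
    intro n m h
    have := g.injective h
    exact hl.1.injective (Vtx.pt.inj this).1
  have hind : ∀ n m, ¬ (vtxGraph R c n₀ y).Adj (g (.pt (lad δ n) i)) (g (.pt (lad δ m) i)) := by
    intro n m h
    rcases g.map_adj_iff.1 h with h | h <;> cases h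
  generalize g (.top δ i) = v at hge hadj
  generalize hw : (fun n => g (.pt (lad δ n) i)) = w at hinj
  have hw' : ∀ n, g (.pt (lad δ n) i) = w n := fun n => congrFun hw n
  simp only [hw'] at hadj hind hrank
  clear hw hw'
  cases v with
  | pt β j =>
    exfalso
    have h1 := hrank 0
    have h0 := hadj 0
    generalize w 0 = w0 at h0 h1
    rcases h0 with h | h
    · cases h
    · cases h with
      | pt_top _ δ' _ n hl' hn => exact lt_irrefl δ (hge.trans_lt ((hn ▸ hl'.2.1 n).trans h1))
  | lab ρ =>
    exfalso
    have h1 := hrank 0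
    have h0 := hadj 0
    generalize w 0 = w0 at h0 h1
    rcases h0 with h | h
    · cases h with
      | top_lab δ' _ _ hl' hn => exact lt_irrefl δ (hge.trans_lt ((hn ▸ hl'.2.1 n₀).trans h1))
    · cases h with
      | lab_node _ s hs hn =>
        subst hn
        exact lt_irrefl δ (hge.trans_lt
          (hF (.node 0 s) (.lab (c s)) (Or.inr (Or.inr (Or.inl ⟨s, rfl, rfl⟩))) h1))
  -- The neighbours of small rank are one label and nodes below `s`; the latter are pairwise
  -- adjacent, so three independent neighbours are already too many.
  | node k s =>
    exfalso
    have key : ∀ n, w n = .lab (c s) ∨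
        ∃ t : Node κ, w n = .node 0 t ∧ t.Below s ∧ t.Valid R y := by
      intro n
      have h1 := hrank n
      rcases hadj n with h | h
      · generalize w n = w0 at h h1
        cases h with
        | lab_node _ s hs hn => exact Or.inl (by rw [hn])
        | node_node t s ht hs hb => exact Or.inr ⟨t, rfl, hb, ht⟩
      · generalize w n = w0 at h h1
        cases h with
        | node_node t s' ht hs hb =>
          exact absurd (hF (.node 0 s') (.node 0 s)
            (Or.inr (Or.inr (Or.inr ⟨s, s', rfl, rfl, hb⟩))) h1) (not_lt.2 hge)
    have key2 : ∀ n m, n ≠ m → w n = .lab (c s) ∨ w m = .lab (c s) := by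
      intro n m hnm
      rcases key n with h | ⟨t, h, hb, hv⟩
      · exact Or.inl h
      rcases key m with h' | ⟨t', h', hb', hv'⟩
      · exact Or.inr h'
      exfalso
      rcases lt_trichotomy t.lev t'.lev with hlt | heq | hlt
      · refine hind n m ?_
        rw [h, h']
        exact Or.inl (.node_node t t' hv hv' (hb.below_of_lev_lt hb' hlt))
      · refine hnm (hinj ?_)
        rw [h, h', hb.2, hb'.2, heq]
      · refine hind m n ?_
        rw [h, h']
        exact Or.inl (.node_node t' t hv' hv (hb'.below_of_lev_lt hb hlt))
    have h01 := key2 0 1 (by decide)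
    have h02 := key2 0 2 (by decide)
    have h12 := key2 1 2 (by decide)
    rcases h01 with h0 | h1
    · rcases h12 with h1 | h2
      · exact absurd (hinj (h0.trans h1.symm)) (by decide)
      · exact absurd (hinj (h0.trans h2.symm)) (by decide)
    · rcases h02 with h0 | h2
      · exact absurd (hinj (h0.trans h1.symm)) (by decide)
      · exact absurd (hinj (h1.trans h2.symm)) (by decide)
  -- A ladder converging to some γ > δ has only finitely many rungs below δ, and its top has just
  -- one label.
  | top γ j =>
    rcases hge.eq_or_lt with heq | hlt
    · exact ⟨j, by rw [show δ = γ from heq]⟩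
    exfalso
    have hl' : IsLadder γ (lad γ) := by
      rcases hadj 0 with h | h
      · generalize w 0 = w0 at h
        cases h; assumption
      · generalize w 0 = w0 at h
        cases h; assumption
    obtain ⟨M, hM⟩ := hl'.2.2 δ hlt
    have key : ∀ n, w n ∈ insert (Vtx.lab (lad γ n₀)) ((fun m => Vtx.pt (lad γ m) j) '' Iio M) := by
      intro n
      have h1 := hrank n
      rcases hadj n with h | h
      · generalize w n = w0 at h h1
        cases h with
        | pt_top β _ _ m _ hm =>
          subst hm
          exact Or.inr ⟨m, hl'.1.lt_iff_lt.1 ((show lad γ m < δ from h1).trans hM), rfl⟩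
      · generalize w n = w0 at h h1
        cases h with
        | top_lab _ _ _ _ hn => exact Or.inl (by rw [hn])
    have hfin : (insert (Vtx.lab (lad γ n₀)) ((fun m => Vtx.pt (lad γ m) j) '' Iio M)).Finite :=
      ((finite_Iio M).image _).insert _
    exact infinite_range_of_injective hinj (hfin.subset (range_subset_iff.2 key))

/-- A label joined to the tops of stationarily many ladders is fixed by every embedding. -/
theorem map_lab_eq (hκ : κ.IsInaccessible) {e : ℕ × Node κ → Pt κ}
    (he : Function.Injective e) {x y : Fn κ} (g : vtxGraph R c n₀ x ↪g vtxGraph R c n₀ y)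
    {ρ : Pt κ} (hρ : ∀ F : Pt κ → Pt κ, ∃ δ, IsLadder δ (lad δ) ∧ IsClosedUnder F δ ∧ lad δ n₀ = ρ) :
    g (.lab ρ) = .lab ρ := by
  obtain ⟨F, hF⟩ := exists_map_top_eq hκ he g
  obtain ⟨δ, hl, hδ, rfl⟩ := hρ F
  have hadj : ∀ i, (vtxGraph R c n₀ y).Adj (g (.top δ i)) (g (.lab (lad δ n₀))) := fun i =>
    g.map_adj_iff.2 (Or.inl (.top_lab δ _ i hl rfl))
  obtain ⟨j, hj⟩ := hF δ hl hδ false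
  obtain ⟨j', hj'⟩ := hF δ hl hδ true
  -- The two tops over δ stay distinct, and their common neighbour must be a label: a point vertex
  -- is joined only to tops carrying its own Boolean.
  have hne : j ≠ j' := by
    rintro rfl
    have := g.injective (hj.trans hj'.symm)
    cases this
  have h1 := hadj false
  have h2 := hadj true
  rw [hj] at h1
  rw [hj'] at h2
  generalize g (.lab (lad δ n₀)) = v at h1 h2
  cases v with
  | lab ρ =>
    rcases h1 with h | h
    · cases h with
      | top_lab _ _ _ _ hn => rw [hn]
    · cases h
  | pt β i =>
    rcases h1 with h | h
    · cases h
    rcases h2 with h' | h'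
    · cases h'
    cases h
    cases h'
    exact absurd rfl hne
  | top _ _ => rcases h1 with h | h <;> cases h
  | node _ _ => rcases h1 with h | h <;> cases h

end Graph

/-! ### Embeddings yield reductions -/

section Backward

variable {κ : Cardinal.{u}}

theorem exists_node_enumeration (hκ : κ.IsInaccessible) :
    ∃ e : ℕ × Node κ → Pt κ, Function.Injective e := by
  have h : #(ULift.{u} ℕ × Node κ) ≤ #(Pt κ) := by
    rw [mk_prod, lift_id, lift_id, mk_ord_toType]
    simpa using (mul_le_mul' hκ.aleph0_lt.le (mk_node_le hκ)).trans
      (mul_eq_self hκ.aleph0_lt.le).le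
  obtain ⟨f⟩ := h
  exact ⟨fun p => f (⟨p.1⟩, p.2), fun p q hpq => by
    have := f.injective hpq
    obtain ⟨h1, h2⟩ := Prod.mk.inj this
    exact Prod.ext (congrArg ULift.down h1) h2⟩

/-- There is a coding of the starting data of the nodes by labels that are fixed by every
embedding. -/
theorem exists_node_code (hκ : κ.IsInaccessible) :
    ∃ (n₀ : ℕ) (c : Node κ → Pt κ), (∀ s t, c s = c t ↔ s.lev = t.lev ∧ s.start = t.start) ∧
      ∀ s, ∀ F : Pt κ → Pt κ, ∃ δ, IsLadder δ (lad δ) ∧ IsClosedUnder F δ ∧ lad δ n₀ = c s := by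
  obtain ⟨n₀, hn⟩ := exists_stationary_fibres hκ
  let P : Set (Pt κ) :=
    {ρ | ∀ F : Pt κ → Pt κ, ∃ δ, IsLadder δ (lad δ) ∧ IsClosedUnder F δ ∧ lad δ n₀ = ρ}
  -- `P` is unbounded, while every set of size less than κ is bounded.
  have hP : κ ≤ #P := by
    by_contra! hlt
    obtain ⟨b, hb⟩ := exists_gt_of_mk_lt hκ hlt
    obtain ⟨ρ, hρ, hρP⟩ := hn b
    exact (hb ρ hρP).not_ge hρ
  obtain ⟨f⟩ := (mk_truncated_le hκ).trans hP
  refine ⟨n₀, fun s => f ⟨(s.lev, s.start), s.trunc_start⟩, fun s t => ?_, fun s => (f _).2⟩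
  rw [Subtype.val_inj, f.injective.eq_iff, Subtype.mk.injEq, Prod.mk.injEq]

variable {D : Fn κ → Fn κ → Fn κ → Prop} {c : Node κ → Pt κ} {n₀ : ℕ}
  {R : Pt κ → Fn κ → Fn κ → Fn κ → Prop}

theorem exists_map_node_eq (hκ : κ.IsInaccessible)
    (hc : ∀ s t, c s = c t ↔ s.lev = t.lev ∧ s.start = t.start)
    (hρ : ∀ s, ∀ F : Pt κ → Pt κ, ∃ δ, IsLadder δ (lad δ) ∧ IsClosedUnder F δ ∧ lad δ n₀ = c s)
    {x y : Fn κ} (g : vtxGraph R c n₀ x ↪g vtxGraph R c n₀ y) (α : Pt κ) :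
    ∃ s : Node κ, g (.node 0 (.of α x [])) = .node 0 s ∧ s.Valid R y ∧ s.lev = α ∧
      s.start = trunc α x := by
  obtain ⟨e, he⟩ := exists_node_enumeration hκ
  have hadj : ∀ α, (vtxGraph R c n₀ y).Adj (.lab (c (.of α x []))) (g (.node 0 (.of α x []))) := by
    intro α
    rw [← map_lab_eq hκ he g (hρ (.of α x []))]
    exact g.map_adj_iff.2 (Or.inl (.lab_node _ _ (Node.valid_of R x α) rfl))
  -- A neighbour of the fixed label is a node with that code or a top. The node at a higher level β
  -- excludes tops: its image is adjacent both to a label and to the image at level α, and no top is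
  -- adjacent to a top or a node.
  obtain ⟨β, hβ⟩ := exists_pt_gt hκ α
  have hαβ : (vtxGraph R c n₀ y).Adj (g (.node 0 (.of α x []))) (g (.node 0 (.of β x []))) := by
    refine g.map_adj_iff.2 (Or.inl (.node_node _ _ (Node.valid_of R x α) (Node.valid_of R x β) ?_))
    exact ⟨hβ, Node.ext rfl (trunc_trunc hβ.le x).symm rfl⟩
  have h1 := hadj α
  have h2 := hadj β
  generalize g (.node 0 (.of β x [])) = w at hαβ h2
  generalize g (.node 0 (.of α x [])) = v at hαβ h1
  rcases h1 with h1 | h1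
  · cases h1 with
    | lab_node _ s hs hcs =>
      obtain ⟨hl, hst⟩ := (hc _ _).1 hcs
      exact ⟨s, rfl, hs, hl, hst⟩
  · exfalso
    cases h1 with
    | top_lab δ _ i _ _ =>
      rcases h2 with h2 | h2
      · cases h2
        rcases hαβ with h | h <;> cases h
      · cases h2
        rcases hαβ with h | h <;> cases h

theorem reflTransGen_of_embedding (hκ : κ.IsInaccessible)
    (hD : ∀ z w ξ, (∀ α, LevelRel D α z w ξ) → D z w ξ)
    (hc : ∀ s t, c s = c t ↔ s.lev = t.lev ∧ s.start = t.start)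
    (hρ : ∀ s, ∀ F : Pt κ → Pt κ, ∃ δ, IsLadder δ (lad δ) ∧ IsClosedUnder F δ ∧ lad δ n₀ = c s)
    {x y : Fn κ} (g : vtxGraph (LevelRel D) c n₀ x ↪g vtxGraph (LevelRel D) c n₀ y) :
    Relation.ReflTransGen (fun z w => ∃ ξ, D z w ξ) x y := by
  choose s hgs hval hlev hstart using exists_map_node_eq hκ hc hρ g
  have hbelow : ∀ α β, β < α → (s α).chain.map (truncPair β) = (s β).chain := by
    intro α β hlt
    have hadj : (vtxGraph (LevelRel D) c n₀ y).Adj (.node 0 (s β)) (.node 0 (s α)) := by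
      rw [← hgs, ← hgs]
      refine g.map_adj_iff.2
        (Or.inl (.node_node _ _ (Node.valid_of _ x β) (Node.valid_of _ x α) ?_))
      exact ⟨hlt, Node.ext rfl (trunc_trunc hlt.le x).symm rfl⟩
    -- Edges are undirected, but the levels, which the embedding preserves on these nodes, decide
    -- which node is the restriction.
    rcases hadj with h | h
    · cases h with
      | node_node _ _ _ _ hb =>
        conv_rhs => rw [hb.2, hlev β]
        rfl
    · cases h with
      | node_node _ _ _ _ hb =>
        have := hb.1
        rw [hlev, hlev] at this
        exact absurd this hlt.not_gt
  have hcoh : ∀ α β, β ≤ α → (s α).chain.map (truncPair β) = (s β).chain := by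
    intro α β hle
    rcases hle.eq_or_lt with rfl | hlt
    · have := (s β).map_chain
      rwa [hlev] at this
    · exact hbelow α β hlt
  have hne : Nonempty (Pt κ) := by
    rw [← mk_ne_zero_iff, mk_ord_toType]
    exact hκ.ne_zero
  obtain ⟨α₀⟩ := hne
  obtain ⟨L, hL⟩ := exists_list_of_coherent hκ (s α₀).chain.length (fun α => (s α).chain)
    (fun α => by
      rcases le_total α α₀ with h | h
      · rw [← hcoh _ _ h, List.length_map]
      · rw [← hcoh _ _ h, List.length_map]) hcoh
  have hchain : IsChainFrom D x L := IsChainFrom.of_forall_level hD fun α => by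
    have := (hval α).1
    rwa [hlev, hstart, hL] at this
  have hend : endPoint x L = y := eq_of_forall_trunc_eq hκ fun α => by
    have := (hval α).2
    rwa [hlev, hstart, hL, endPoint_map_trunc] at this
  exact hend ▸ hchain.reflTransGen

end Backward

/-! ### Borel sets and Borel maps -/

section Borel

variable {κ : Cardinal.{u}} {X Y : Type u} [TopologicalSpace X] [TopologicalSpace Y]

theorem IsBorelSet.of_isOpen {U : Set X} (h : IsOpen U) : IsBorelSet κ U :=
  IsLamBorel.of_isOpen U h

theorem IsBorelSet.compl {B : Set X} (h : IsBorelSet κ B) : IsBorelSet κ Bᶜ :=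
  IsLamBorel.compl B h

theorem IsBorelSet.iUnion {ι : Type u} (hι : #ι ≤ κ) {f : ι → Set X}
    (h : ∀ i, IsBorelSet κ (f i)) : IsBorelSet κ (⋃ i, f i) := by
  rw [← sUnion_range]
  refine IsLamBorel.sUnion _ (Order.lt_succ_of_le (mk_range_le.trans hι)) ?_
  rintro _ ⟨i, rfl⟩
  exact h i

theorem IsBorelSet.iInter {ι : Type u} (hι : #ι ≤ κ) {f : ι → Set X}
    (h : ∀ i, IsBorelSet κ (f i)) : IsBorelSet κ (⋂ i, f i) := by
  have := (IsBorelSet.iUnion hι fun i => (h i).compl).compl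
  rwa [compl_iUnion, iInter_congr fun i => compl_compl (f i)] at this

theorem IsBorelSet.const (p : Prop) : IsBorelSet κ {_x : X | p} := by
  by_cases h : p
  · simpa [h] using IsBorelSet.of_isOpen (κ := κ) (isOpen_univ (X := X))
  · simpa [h] using IsBorelSet.of_isOpen (κ := κ) (isOpen_empty (X := X))

theorem IsBorelSet.union (hκ : ℵ₀ ≤ κ) {A B : Set X} (hA : IsBorelSet κ A)
    (hB : IsBorelSet κ B) : IsBorelSet κ (A ∪ B) := by
  have h : A ∪ B = ⋃ i : ULift.{u} Bool, cond i.down A B := by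
    ext x
    simp [or_comm]
  rw [h]
  refine IsBorelSet.iUnion ?_ ?_
  · exact ((lt_aleph0_of_finite _).trans_le hκ).le
  · rintro ⟨_ | _⟩
    · exact hB
    · exact hA

theorem IsBorelSet.inter (hκ : ℵ₀ ≤ κ) {A B : Set X} (hA : IsBorelSet κ A)
    (hB : IsBorelSet κ B) : IsBorelSet κ (A ∩ B) := by
  have := (hA.compl.union hκ hB.compl).compl
  rwa [compl_union, compl_compl, compl_compl] at this

theorem isBorelMap_of_continuous {f : X → Y} (hf : Continuous f) : IsBorelMap κ f :=
  fun _ hU => IsBorelSet.of_isOpen (hU.preimage hf)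

/-- Borel sets do not separate topologically indistinguishable points. -/
theorem IsBorelSet.mem_iff {B : Set X} (hB : IsBorelSet κ B) {x y : X}
    (h : ∀ U : Set X, IsOpen U → (x ∈ U ↔ y ∈ U)) : x ∈ B ↔ y ∈ B := by
  induction hB with
  | of_isOpen U hU => exact h U hU
  | compl B _ ih => exact not_congr ih
  | sUnion S _ _ ih =>
    exact exists_congr fun B => and_congr_right fun hB => ih B hB

/-- Topologically indistinguishable points have images with the same coordinates, since coordinate
sets pull back to Borel sets. This is what makes `charFn` injective. -/
theorem IsStandardBorel.eq_of_forall_isOpen (hκ : ℵ₀ ≤ κ) (hX : IsStandardBorel κ X) {x y : X}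
    (h : ∀ U : Set X, IsOpen U → (x ∈ U ↔ y ∈ U)) : x = y := by
  obtain ⟨-, B, -, e, he, -⟩ := hX
  refine e.injective (Subtype.ext (funext fun i => ?_))
  have hone : #({i} : Set (Pt κ)) < κ := by
    rw [mk_singleton]
    exact one_lt_aleph0.trans_le hκ
  have hO : IsOpen {z : Baire κ | z i = (e x : Baire κ) i} := by
    rw [isOpen_bSpace_iff hκ]
    intro z hz
    exact ⟨{i}, hone, fun y hy => (hy i rfl).trans hz⟩
  have := (he _ (hO.preimage continuous_subtype_val)).mem_iff h
  exact (this.1 rfl).symm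

end Borel

/-! ### Bases of spaces of functions -/

section Cylinders

variable {κ : Cardinal.{u}} {J : Type u}

/-- The cylinders given by an enumeration of the index set. -/
def cylinder (e : J → Pt κ) (p : Σ α : Pt κ, ({j : J // e j < α} → Prop)) : Set (BSpace κ J Prop) :=
  {y | ∀ j : {j : J // e j < p.1}, y j.1 = p.2 j}

theorem mk_subtype_lt {e : J → Pt κ} (he : Function.Injective e) (α : Pt κ) :
    #{j : J // e j < α} < κ := by
  refine lt_of_le_of_lt ?_ (mk_Iio_pt_lt α)
  exact mk_le_of_injective (f := fun j => (⟨e j.1, j.2⟩ : Iio α)) fun a b h =>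
    Subtype.ext (he (congrArg Subtype.val h))

/-- By regularity every small domain lies in an initial segment of the enumeration. -/
theorem isTopologicalBasis_cylinder (hκ : κ.IsInaccessible) {e : J → Pt κ}
    (he : Function.Injective e) :
    IsTopologicalBasis (range (cylinder e : _ → Set (BSpace κ J Prop))) := by
  refine isTopologicalBasis_of_isOpen_of_nhds ?_ ?_
  · rintro _ ⟨p, rfl⟩
    rw [isOpen_bSpace_iff hκ.aleph0_lt.le]
    exact fun x hx => ⟨{j | e j < p.1}, mk_subtype_lt he p.1,
      fun y hy j => (hy j.1 j.2).trans (hx j)⟩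
  · intro x O hx hO
    obtain ⟨d, hd, h⟩ := (isOpen_bSpace_iff hκ.aleph0_lt.le).1 hO x hx
    obtain ⟨α, hα⟩ := exists_gt_of_mk_lt hκ (S := e '' d) (mk_image_le.trans_lt hd)
    refine ⟨_, ⟨⟨α, fun j => x j.1⟩, rfl⟩, fun j => rfl, fun y hy => h y fun j hj => ?_⟩
    exact hy ⟨j, hα _ ⟨j, hj, rfl⟩⟩

theorem mk_range_cylinder_le (hκ : κ.IsInaccessible) {e : J → Pt κ}
    (he : Function.Injective e) :
    #(range (cylinder e : _ → Set (BSpace κ J Prop))) ≤ κ := by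
  refine mk_range_le.trans ?_
  rw [mk_sigma]
  calc (Cardinal.sum fun α : Pt κ => #({j : J // e j < α} → Prop))
      ≤ Cardinal.sum fun _ : Pt κ => κ :=
        sum_le_sum _ _ fun α => by
          have h : #({j : J // e j < α} → Prop) ≤ #({j : J // e j < α} → ULift.{u} Prop) :=
            mk_le_of_injective (f := fun x j => ⟨x j⟩) fun x y hxy =>
              funext fun j => congrArg ULift.down (congrFun hxy j)
          exact h.trans (mk_fun_le hκ (mk_subtype_lt he α)
            ((lt_aleph0_of_finite _).trans hκ.aleph0_lt).le)
    _ = κ := by simp [mul_eq_self hκ.aleph0_lt.le]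

theorem exists_injective_pt {α : Type u} (h : #α ≤ κ) :
    ∃ e : α → Pt κ, Function.Injective e := by
  rw [← mk_ord_toType κ] at h
  obtain ⟨e⟩ := h
  exact ⟨e, e.injective⟩

/-- An open set is a union of at most κ cylinders, each an intersection of fewer than κ coordinate
conditions. -/
theorem isBorelMap_of_coord (hκ : κ.IsInaccessible) (hJ : #J ≤ κ)
    {X : Type u} [TopologicalSpace X] (f : X → BSpace κ J Prop)
    (hf : ∀ j, IsBorelSet κ {x | f x j}) : IsBorelMap κ f := by
  obtain ⟨e, he⟩ := exists_injective_pt hJ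
  intro O hO
  obtain ⟨S, hS, rfl⟩ := (isTopologicalBasis_cylinder hκ he).open_eq_sUnion hO
  rw [sUnion_eq_iUnion, preimage_iUnion]
  refine IsBorelSet.iUnion ((mk_le_mk_of_subset hS).trans (mk_range_cylinder_le hκ he)) ?_
  rintro ⟨s, hs⟩
  obtain ⟨p, rfl⟩ := hS hs
  have h : f ⁻¹' cylinder e p = ⋂ j : {j : J // e j < p.1}, {x | f x j.1 = p.2 j} := by
    ext x
    simp only [mem_iInter]
    rfl
  rw [h]
  refine IsBorelSet.iInter (mk_subtype_lt he p.1).le fun j => ?_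
  by_cases hp : p.2 j
  · simpa only [eq_iff_iff, hp, iff_true] using hf j.1
  · simpa only [eq_iff_iff, hp, iff_false] using! (hf j.1).compl

end Cylinders

/-! ### The space of graphs -/

section GraphSpace

variable {κ : Cardinal.{u}}

theorem exists_equiv_of_mk {α : Type u} (h : #α = κ) : Nonempty (Pt κ ≃ α) :=
  Cardinal.eq.1 ((mk_ord_toType κ).trans h.symm)

theorem exists_pair_pt (hκ : κ.IsInaccessible) : ∃ a b : Pt κ, a ≠ b := by
  have hne : Nonempty (Pt κ) := by
    rw [← mk_ne_zero_iff, mk_ord_toType]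
    exact hκ.ne_zero
  obtain ⟨a⟩ := hne
  obtain ⟨b, hb⟩ := exists_pt_gt hκ a
  exact ⟨a, b, hb.ne⟩

theorem mk_pt_prod (hκ : κ.IsInaccessible) : #(Pt κ × Pt κ) = κ := by
  simp [mul_eq_self hκ.aleph0_lt.le]

theorem isKappaSpace_graphSpace (hκ : κ.IsInaccessible) : IsKappaSpace κ (GraphSpace κ) := by
  obtain ⟨e, he⟩ := exists_injective_pt (mk_pt_prod hκ).le
  refine ⟨_, (isTopologicalBasis_cylinder hκ he).induced GraphSpace.code, ?_⟩
  exact mk_image_le.trans (mk_range_cylinder_le hκ he)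

/-- The graph coded by a point of the generalized Baire space. -/
def decodeGraph (q : Pt κ ≃ Pt κ × Pt κ) (a : Pt κ) (z : Baire κ) : GraphSpace κ :=
  SimpleGraph.fromRel fun p r => z (q.symm (p, r)) = a

open Classical in
/-- The code of a graph in the generalized Baire space. -/
noncomputable def encodeGraph (q : Pt κ ≃ Pt κ × Pt κ) (a b : Pt κ) (G : GraphSpace κ) : Baire κ :=
  fun β => if G.code (q β) then a else b

variable {q : Pt κ ≃ Pt κ × Pt κ} {a b : Pt κ}

theorem code_decodeGraph (z : Baire κ) (p : Pt κ × Pt κ) :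
    (decodeGraph q a z).code p ↔ p.1 ≠ p.2 ∧ (z (q.symm p) = a ∨ z (q.symm p.swap) = a) :=
  Iff.rfl

theorem decodeGraph_encodeGraph (hab : a ≠ b) (G : GraphSpace κ) :
    decodeGraph q a (encodeGraph q a b G) = G := by
  have h : ∀ p, encodeGraph q a b G (q.symm p) = a ↔ G.code p := by
    intro p
    rw [encodeGraph, Equiv.apply_symm_apply]
    split_ifs with hp <;> simp [hp, hab.symm]
  refine SimpleGraph.ext (funext₂ fun p r => propext ?_)
  refine (code_decodeGraph _ (p, r)).trans ?_
  rw [h, h]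
  constructor
  · rintro ⟨-, h | h⟩
    · exact h
    · exact SimpleGraph.Adj.symm h
  · exact fun h => ⟨SimpleGraph.Adj.ne h, Or.inl h⟩

theorem continuous_decodeGraph (hκ : ℵ₀ ≤ κ) : Continuous (decodeGraph q a) := by
  refine continuous_induced_rng.2 ?_
  refine continuous_bSpace_of_coord hκ _ (fun p => {q.symm p, q.symm p.swap})
    (fun p => by simp) fun x y p h => propext ?_
  refine (code_decodeGraph x p).trans (Iff.trans ?_ (code_decodeGraph y p).symm)
  rw [h _ (by simp), h _ (by simp)]

theorem continuous_encodeGraph (hκ : ℵ₀ ≤ κ) : Continuous (encodeGraph q a b) := by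
  classical
  let f : BSpace κ (Pt κ × Pt κ) Prop → Baire κ := fun φ β => if φ (q β) then a else b
  have h : Continuous f := by
    refine continuous_bSpace_of_coord hκ _ (fun β => {q β}) (fun β => by simp) fun x y β h => ?_
    simp only [f, h (q β) rfl]
  exact h.comp continuous_induced_dom

/-- Encoding identifies graphs with the fixed points of encoding after decoding, a closed set
because coordinates separate points. -/
theorem isStandardBorel_graphSpace (hκ : κ.IsInaccessible) : IsStandardBorel κ (GraphSpace κ) := by
  have h0 := hκ.aleph0_lt.le
  obtain ⟨a, b, hab⟩ := exists_pair_pt hκ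
  obtain ⟨q⟩ := exists_equiv_of_mk (mk_pt_prod hκ)
  have hT2 : ∀ {f g : Baire κ → Baire κ}, Continuous f → Continuous g → IsClosed {z | f z = g z} := by
    intro f g hf hg
    rw [← isOpen_compl_iff, isOpen_iff_mem_nhds]
    intro z hz
    obtain ⟨i, hi⟩ := Function.ne_iff.1 hz
    have hO : ∀ c : Pt κ, IsOpen {z : Baire κ | z i = c} := by
      intro c
      rw [isOpen_bSpace_iff h0]
      exact fun y hy => ⟨{i}, by
        rw [mk_singleton]
        exact one_lt_aleph0.trans_le h0, fun y' hy' => (hy' i rfl).trans hy⟩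
    filter_upwards [((hO (f z i)).preimage hf).mem_nhds rfl, ((hO (g z i)).preimage hg).mem_nhds rfl]
      with y hy1 hy2 heq
    have h1 : f y i = f z i := hy1
    have h2 : g y i = g z i := hy2
    exact hi (by rw [← h1, ← h2, show f y = g y from heq])
  let B : Set (Baire κ) := {z | encodeGraph q a b (decodeGraph q a z) = z}
  have hB : IsClosed B :=
    hT2 ((continuous_encodeGraph h0).comp (continuous_decodeGraph h0)) continuous_id
  refine ⟨isKappaSpace_graphSpace hκ, B, ?_, ⟨⟨fun G => ⟨encodeGraph q a b G, ?_⟩,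
    fun z => decodeGraph q a z, fun G => decodeGraph_encodeGraph hab G,
    fun z => Subtype.ext z.2⟩, ?_, ?_⟩⟩
  · rw [← compl_compl B]
    exact (IsBorelSet.of_isOpen hB.isOpen_compl).compl
  · exact congrArg _ (decodeGraph_encodeGraph hab G)
  · exact isBorelMap_of_continuous ((continuous_encodeGraph h0).subtype_mk _)
  · exact isBorelMap_of_continuous ((continuous_decodeGraph h0).comp continuous_subtype_val)

theorem isAnalytic_graphEmbeddable (hκ : κ.IsInaccessible) :
    IsAnalytic κ {p : GraphSpace κ × GraphSpace κ | GraphEmbeddable κ p.1 p.2} := by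
  have h0 := hκ.aleph0_lt.le
  obtain ⟨a, b, hab⟩ := exists_pair_pt hκ
  obtain ⟨q⟩ := exists_equiv_of_mk (mk_pt_prod hκ)
  obtain ⟨t⟩ := exists_equiv_of_mk (κ := κ) (α := Pt κ × Pt κ × Pt κ) (by
    simp [mul_eq_self h0])
  let z₁ : Baire κ → Baire κ := fun z β => (t (z β)).1
  let z₂ : Baire κ → Baire κ := fun z β => (t (z β)).2.1
  let z₃ : Baire κ → Baire κ := fun z β => (t (z β)).2.2
  have hz₁ : Continuous z₁ := continuous_bSpace_of_coord h0 _ (fun β => {β}) (fun β => by simp)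
    fun x y β h => by simp only [z₁, h β rfl]
  have hz₂ : Continuous z₂ := continuous_bSpace_of_coord h0 _ (fun β => {β}) (fun β => by simp)
    fun x y β h => by simp only [z₂, h β rfl]
  -- One point of the Baire space packs codes of both graphs and the embedding; every violation of
  -- the requirements is visible on finitely many coordinates.
  let C : Set (Baire κ) := {z | Function.Injective (z₃ z) ∧ ∀ p r,
    ((decodeGraph q a (z₂ z)).code (z₃ z p, z₃ z r) ↔ (decodeGraph q a (z₁ z)).code (p, r))}
  have hC : IsClosed C := by
    rw [isClosed_bSpace_iff h0]
    intro z hz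
    have hfin : ∀ d : Set (Pt κ), d.Finite → #d < κ := fun d hd => hd.lt_aleph0.trans_le h0
    rcases not_and_or.1 hz with hz | hz
    · simp only [Function.Injective, not_forall] at hz
      obtain ⟨p, r, hpr, hne⟩ := hz
      refine ⟨{p, r}, hfin _ (by simp), fun y hy hyC => hne (hyC.1 ?_)⟩
      have h1 := hy p (by simp)
      have h2 := hy r (by simp)
      simp only [z₃] at hpr ⊢
      rw [h1, h2, hpr]
    · simp only [not_forall] at hz
      obtain ⟨p, r, hpr⟩ := hz
      refine ⟨{p, r, q.symm (p, r), q.symm (r, p), q.symm (z₃ z p, z₃ z r),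
        q.symm (z₃ z r, z₃ z p)}, hfin _ (by simp), fun y hy hyC => hpr ?_⟩
      have h := hyC.2 p r
      rw [code_decodeGraph, code_decodeGraph] at h ⊢
      have h1 : z₃ y p = z₃ z p := by simp only [z₃, hy p (by simp)]
      have h2 : z₃ y r = z₃ z r := by simp only [z₃, hy r (by simp)]
      rw [h1, h2] at h
      simp only [Prod.swap_prod_mk, z₁, z₂] at h ⊢
      rwa [hy (q.symm (p, r)) (by simp), hy (q.symm (r, p)) (by simp),
        hy (q.symm (z₃ z p, z₃ z r)) (by simp), hy (q.symm (z₃ z r, z₃ z p)) (by simp)] at h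
  refine ⟨C, hC, fun z => (decodeGraph q a (z₁ z), decodeGraph q a (z₂ z)), ?_, ?_⟩
  · exact (((continuous_decodeGraph h0).comp hz₁).prodMk
      ((continuous_decodeGraph h0).comp hz₂)).comp continuous_subtype_val
  · ext ⟨G, H⟩
    constructor
    · rintro ⟨⟨z, hz⟩, hzGH⟩
      obtain ⟨rfl, rfl⟩ := Prod.mk.inj hzGH
      exact ⟨⟨⟨z₃ z, hz.1⟩, fun {p r} => hz.2 p r⟩⟩
    · rintro ⟨g⟩
      let z : Baire κ := fun β => t.symm (encodeGraph q a b G β, encodeGraph q a b H β, g.toFun β)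
      have e1 : z₁ z = encodeGraph q a b G := by funext β; simp [z₁, z]
      have e2 : z₂ z = encodeGraph q a b H := by funext β; simp [z₂, z]
      have e3 : z₃ z = g.toFun := by funext β; simp [z₃, z]
      refine ⟨⟨z, ?_, ?_⟩, ?_⟩
      · rw [e3]
        exact g.injective
      · intro p r
        rw [e1, e2, e3, decodeGraph_encodeGraph hab, decodeGraph_encodeGraph hab]
        exact g.map_adj_iff
      · refine Prod.ext ?_ ?_
        · change decodeGraph q a (z₁ z) = G
          rw [e1, decodeGraph_encodeGraph hab]
        · change decodeGraph q a (z₂ z) = H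
          rw [e2, decodeGraph_encodeGraph hab]

theorem isAnalyticQO_graphEmbeddable (hκ : κ.IsInaccessible) :
    IsAnalyticQO κ (GraphEmbeddable κ) where
  standardBorel := isStandardBorel_graphSpace hκ
  refl _ := ⟨RelEmbedding.refl _⟩
  trans _ _ _ h₁ h₂ := ⟨RelEmbedding.trans h₁.some h₂.some⟩
  analytic := isAnalytic_graphEmbeddable hκ

end GraphSpace

/-! ### Coding an analytic quasi-order -/

section Coding

variable {κ : Cardinal.{u}} {X : Type u}

open Classical in
/-- The characteristic function of the set of basic open sets containing `x`. -/
noncomputable def charFn (U : Pt κ → Set X) (a b : Pt κ) (x : X) : Fn κ :=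
  fun i => if x ∈ U i then a else b

/-- `z` is the characteristic function of the image of `c` under `f`; membership is
witnessed by a neighbourhood of `c`, whose size is given by `w`. -/
def Codes (U : Pt κ → Set X) (a b : Pt κ) (C : Set (Baire κ)) (f : C → X) (z : Fn κ)
    (c : Baire κ) (w : Fn κ) : Prop :=
  ∀ i, (z i = a ∧ ∀ c' : C, c'.1 ∈ ball c (w i) → f c' ∈ U i) ∨
    (z i = b ∧ ∀ c' : C, c'.1 = c → f c' ∉ U i)

variable {U : Pt κ → Set X} {a b : Pt κ} {C : Set (Baire κ)} {f : C → X}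

theorem Codes.eq_charFn {z : Fn κ} {c : C} {w : Fn κ} (h : Codes U a b C f z c w) :
    z = charFn U a b (f c) := by
  funext i
  rw [charFn]
  rcases h i with ⟨h1, h2⟩ | ⟨h1, h2⟩
  · rw [if_pos (h2 c fun _ _ => rfl), h1]
  · rw [if_neg (h2 c rfl), h1]

variable [TopologicalSpace X]

theorem exists_ball_of_isOpen (hκ : κ.IsInaccessible) (hf : Continuous f) {O : Set X}
    (hO : IsOpen O) {c : C} (hc : f c ∈ O) :
    ∃ α, ∀ c' : C, c'.1 ∈ ball c.1 α → f c' ∈ O := by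
  obtain ⟨V, hV, hVO⟩ := isOpen_induced_iff.1 (hO.preimage hf)
  have hcV : c ∈ Subtype.val ⁻¹' V := by
    rw [hVO]
    exact hc
  obtain ⟨α, hα⟩ := (isOpen_baire_iff hκ).1 hV c.1 hcV
  refine ⟨α, fun c' hc' => ?_⟩
  have h : c' ∈ Subtype.val ⁻¹' V := hα hc'
  rw [hVO] at h
  exact h

theorem exists_codes (hκ : κ.IsInaccessible) (hU : ∀ i, IsOpen (U i)) (hf : Continuous f) (c : C) :
    ∃ w, Codes U a b C f (charFn U a b (f c)) c w := by
  have h : ∀ i, ∃ α, f c ∈ U i → ∀ c' : C, c'.1 ∈ ball c.1 α → f c' ∈ U i := by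
    intro i
    by_cases hi : f c ∈ U i
    · obtain ⟨α, hα⟩ := exists_ball_of_isOpen hκ hf (hU i) hi
      exact ⟨α, fun _ => hα⟩
    · exact ⟨i, fun h => absurd h hi⟩
  choose w hw using h
  refine ⟨w, fun i => ?_⟩
  by_cases hi : f c ∈ U i
  · exact Or.inl ⟨if_pos hi, hw i hi⟩
  · refine Or.inr ⟨if_neg hi, fun c' hc' => ?_⟩
    rw [Subtype.ext hc']
    exact hi

/-- The recorded radius `w i` makes membership in `U i` a condition on boundedly many coordinates.
Non-membership passes to the limit because, by continuity, `f c ∈ U i` would put all close enough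
approximations in `U i`. -/
theorem codes_of_forall_level (hκ : κ.IsInaccessible) (hU : ∀ i, IsOpen (U i))
    (hf : Continuous f) {z w : Fn κ} (c : C)
    (h : ∀ α, ∃ (z' w' : Fn κ) (c' : C), Codes U a b C f z' c' w' ∧
      ∀ β < α, z' β = z β ∧ w' β = w β ∧ c'.1 β = c.1 β) :
    Codes U a b C f z c w := by
  intro i
  obtain ⟨i', hi'⟩ := exists_pt_gt hκ i
  obtain ⟨z₁, w₁, c₁, h₁, hα₁⟩ := h (max i' (w i))
  have hi : i < max i' (w i) := lt_max_of_lt_left hi'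
  obtain ⟨e1, e2, -⟩ := hα₁ i hi
  rcases h₁ i with ⟨h2, h3⟩ | ⟨h2, -⟩
  · refine Or.inl ⟨e1 ▸ h2, fun c' hc' => h3 c' fun β hβ => ?_⟩
    rw [e2] at hβ
    exact (hc' β hβ).trans (hα₁ β (lt_max_of_lt_right hβ)).2.2.symm
  -- Approximations at different levels may satisfy different alternatives, so the first alternative
  -- for the limit itself is split off before refuting `f c ∈ U i`.
  · by_cases hz : z i = a ∧ ∀ c' : C, c'.1 ∈ ball c.1 (w i) → f c' ∈ U i
    · exact Or.inl hz
    refine Or.inr ⟨e1 ▸ h2, fun c' hc' hcU => ?_⟩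
    rw [Subtype.ext hc'] at hcU
    obtain ⟨α, hα⟩ := exists_ball_of_isOpen hκ hf (hU i) hcU
    obtain ⟨z₂, w₂, c₂, h₂, hα₂⟩ := h (max (max i' (w i)) α)
    obtain ⟨e1', e2', -⟩ := hα₂ i (lt_max_of_lt_left hi)
    rcases h₂ i with ⟨h4, h5⟩ | ⟨-, h5⟩
    · refine hz ⟨e1' ▸ h4, fun c'' hc'' => h5 c'' fun β hβ => ?_⟩
      rw [e2'] at hβ
      exact (hc'' β hβ).trans
        (hα₂ β (lt_max_of_lt_left (lt_max_of_lt_right hβ))).2.2.symm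
    · exact h5 c₂ rfl (hα c₂ fun β hβ => (hα₂ β (lt_max_of_lt_right hβ)).2.2)

/-- Given a continuous function `f` from a closed set into `X × X`, there is a set of triples whose
projection is the set of codes of the range of `f`, and which is determined by the restrictions of
the triples. -/
theorem exists_codes_pair (hκ : κ.IsInaccessible) (hU : ∀ i, IsOpen (U i)) (hC : IsClosed C)
    {F : C → X × X} (hF : Continuous F) :
    ∃ D : Fn κ → Fn κ → Fn κ → Prop,
      (∀ z w ξ, (∀ α, LevelRel D α z w ξ) → D z w ξ) ∧
      ∀ z w, (∃ ξ, D z w ξ) ↔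
        ∃ c, z = charFn U a b (F c).1 ∧ w = charFn U a b (F c).2 := by
  obtain ⟨t⟩ := exists_equiv_of_mk (κ := κ) (α := Pt κ × Pt κ × Pt κ) (by
    simp [mul_eq_self hκ.aleph0_lt.le])
  have h₁ := hF.fst
  have h₂ := hF.snd
  let p₀ : Fn κ → Baire κ := fun ξ β => (t (ξ β)).1
  let p₁ : Fn κ → Fn κ := fun ξ β => (t (ξ β)).2.1
  let p₂ : Fn κ → Fn κ := fun ξ β => (t (ξ β)).2.2
  -- The witness packs a point of `C` and the radii for the two coordinates of its image; sharing
  -- the point ties `z` and `w` to one pair in the range of `F`.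
  let D : Fn κ → Fn κ → Fn κ → Prop := fun z w ξ => p₀ ξ ∈ C ∧
    Codes U a b C (fun c => (F c).1) z (p₀ ξ) (p₁ ξ) ∧
    Codes U a b C (fun c => (F c).2) w (p₀ ξ) (p₂ ξ)
  refine ⟨D, fun z w ξ h => ?_, fun z w => ⟨?_, ?_⟩⟩
  · have h' : ∀ α, ∃ z' w' ξ', D z' w' ξ' ∧ ∀ β < α, z' β = z β ∧ w' β = w β ∧ ξ' β = ξ β := by
      intro α
      obtain ⟨z', w', ξ', h0, h1, h2, h3⟩ := h α
      rw [trunc_eq_trunc_iff] at h1 h2 h3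
      exact ⟨z', w', ξ', h0, fun β hβ => ⟨h1 β hβ, h2 β hβ, h3 β hβ⟩⟩
    have hξC : p₀ ξ ∈ C := by
      by_contra hn
      obtain ⟨α, hα⟩ := (isOpen_baire_iff hκ).1 hC.isOpen_compl _ hn
      obtain ⟨z', w', ξ', h0, h1⟩ := h' α
      refine hα (fun β hβ => ?_) h0.1
      simp only [p₀, (h1 β hβ).2.2]
    refine ⟨hξC, ?_, ?_⟩
    · refine codes_of_forall_level hκ hU h₁ ⟨p₀ ξ, hξC⟩ fun α => ?_
      obtain ⟨z', w', ξ', h0, h1⟩ := h' α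
      refine ⟨z', p₁ ξ', ⟨p₀ ξ', h0.1⟩, h0.2.1, fun β hβ => ⟨(h1 β hβ).1, ?_, ?_⟩⟩
      · simp only [p₁, (h1 β hβ).2.2]
      · simp only [p₀, (h1 β hβ).2.2]
    · refine codes_of_forall_level hκ hU h₂ ⟨p₀ ξ, hξC⟩ fun α => ?_
      obtain ⟨z', w', ξ', h0, h1⟩ := h' α
      refine ⟨w', p₂ ξ', ⟨p₀ ξ', h0.1⟩, h0.2.2, fun β hβ => ⟨(h1 β hβ).2.1, ?_, ?_⟩⟩
      · simp only [p₂, (h1 β hβ).2.2]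
      · simp only [p₀, (h1 β hβ).2.2]
  · rintro ⟨ξ, hξ, h1, h2⟩
    exact ⟨⟨p₀ ξ, hξ⟩, h1.eq_charFn (c := ⟨p₀ ξ, hξ⟩), h2.eq_charFn (c := ⟨p₀ ξ, hξ⟩)⟩
  · rintro ⟨c, rfl, rfl⟩
    obtain ⟨w₁, hw₁⟩ := exists_codes (a := a) (b := b) hκ hU h₁ c
    obtain ⟨w₂, hw₂⟩ := exists_codes (a := a) (b := b) hκ hU h₂ c
    refine ⟨fun β => t.symm (c.1 β, w₁ β, w₂ β), ?_⟩
    have e0 : p₀ (fun β => t.symm (c.1 β, w₁ β, w₂ β)) = c.1 := by funext β; simp [p₀]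
    have e1 : p₁ (fun β => t.symm (c.1 β, w₁ β, w₂ β)) = w₁ := by funext β; simp [p₁]
    have e2 : p₂ (fun β => t.symm (c.1 β, w₁ β, w₂ β)) = w₂ := by funext β; simp [p₂]
    refine ⟨?_, ?_, ?_⟩
    · rw [e0]
      exact c.2
    · rw [e0, e1]
      exact hw₁
    · rw [e0, e2]
      exact hw₂

/-- An indexed basis of a `κ`-space. -/
theorem IsKappaSpace.exists_basis (hX : IsKappaSpace κ X) :
    ∃ U : Pt κ → Set X, (∀ i, IsOpen (U i)) ∧
      ∀ O, IsOpen O → ∀ x ∈ O, ∃ i, x ∈ U i ∧ U i ⊆ O := by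
  obtain ⟨B, hB, hBκ⟩ := hX
  obtain ⟨e, he⟩ := exists_injective_pt hBκ
  classical
  refine ⟨fun i => if h : ∃ s : B, e s = i then h.choose.1 else ∅, fun i => ?_, ?_⟩
  · dsimp only
    split_ifs with h
    · exact hB.isOpen h.choose.2
    · exact isOpen_empty
  · intro O hO x hx
    obtain ⟨s, hs, hxs, hsO⟩ := hB.exists_subset_of_mem_open hx hO
    refine ⟨e ⟨s, hs⟩, ?_⟩
    have h : ∃ s' : B, e s' = e ⟨s, hs⟩ := ⟨_, rfl⟩
    have hc : h.choose.1 = s := congrArg Subtype.val (he h.choose_spec)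
    dsimp only
    rw [dif_pos h, hc]
    exact ⟨hxs, hsO⟩

end Coding

/-! ### The reduction -/

section Reduction

variable {κ : Cardinal.{u}} {X : Type u} [TopologicalSpace X]

theorem isBorelSet_trunc_charFn (hκ : κ.IsInaccessible) {U : Pt κ → Set X}
    (hU : ∀ i, IsOpen (U i)) (a b α : Pt κ) (z : Fn κ) :
    IsBorelSet κ {x | z = trunc α (charFn U a b x)} := by
  have h : {x | z = trunc α (charFn U a b x)} =
      ⋂ i, ((U i ∩ {_x | z i = if i < α then a else α}) ∪
        ((U i)ᶜ ∩ {_x | z i = if i < α then b else α})) := by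
    ext x
    simp only [mem_iInter]
    refine funext_iff.trans (forall_congr' fun i => ?_)
    by_cases hx : x ∈ U i <;> simp [trunc, charFn, hx]
  have h0 := hκ.aleph0_lt.le
  rw [h]
  refine IsBorelSet.iInter (mk_ord_toType κ).le fun i => ?_
  exact ((IsBorelSet.of_isOpen (hU i)).inter h0 (IsBorelSet.const _)).union h0
    ((IsBorelSet.of_isOpen (hU i)).compl.inter h0 (IsBorelSet.const _))

/-- With both vertices fixed, `x` matters only through the validity of nodes, and there only through
the end point condition. -/
theorem isBorelSet_edge (hκ : κ.IsInaccessible) {U : Pt κ → Set X} (hU : ∀ i, IsOpen (U i))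
    (a b : Pt κ) (R : Pt κ → Fn κ → Fn κ → Fn κ → Prop) (c : Node κ → Pt κ) (n₀ : ℕ)
    (v w : Vtx κ) : IsBorelSet κ {x | Edge R c n₀ (charFn U a b x) v w} := by
  have h0 := hκ.aleph0_lt.le
  have hvalid : ∀ s : Node κ, IsBorelSet κ {x | s.Valid R (charFn U a b x)} := fun s =>
    (IsBorelSet.const (IsChainFrom (R s.lev) s.start s.chain)).inter h0
      (isBorelSet_trunc_charFn hκ hU a b s.lev (endPoint s.start s.chain))
  -- An edge for a single `x₀` reveals the kind of edge and its side conditions, which do not depend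
  -- on the point.
  by_cases hex : ∃ x, Edge R c n₀ (charFn U a b x) v w
  · obtain ⟨x₀, h⟩ := hex
    cases h with
    | pt_top β δ i n hl hn =>
      have := IsBorelSet.const (κ := κ) (X := X) True
      convert this using 3
      exact iff_true_intro (.pt_top β δ i n hl hn)
    | top_lab δ ρ i hl hn =>
      have := IsBorelSet.const (κ := κ) (X := X) True
      convert this using 3
      exact iff_true_intro (.top_lab δ ρ i hl hn)
    | lab_node ρ s hs hn =>
      convert hvalid s using 3
      refine ⟨fun h => ?_, fun h => .lab_node ρ s h hn⟩
      cases h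
      assumption
    | node_node t s ht hs hb =>
      convert (hvalid t).inter h0 (hvalid s) using 1
      ext x
      refine ⟨fun h => ?_, fun h => .node_node t s h.1 h.2 hb⟩
      cases h with
      | node_node _ _ ht hs _ => exact ⟨ht, hs⟩
  · have := IsBorelSet.const (κ := κ) (X := X) False
    convert this using 3
    exact iff_false_intro fun h => hex ⟨_, h⟩

theorem borelReducible_graphEmbeddable (hκ : κ.IsInaccessible) {R : X → X → Prop}
    (hR : IsAnalyticQO κ R) : BorelReducible κ R (GraphEmbeddable κ) := by
  obtain ⟨U, hU, hbasis⟩ := hR.standardBorel.1.exists_basis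
  obtain ⟨a, b, hab⟩ := exists_pair_pt hκ
  obtain ⟨C, hC, F, hF, hFR⟩ := hR.analytic
  have hinj : Function.Injective (charFn U a b) := by
    intro x y hxy
    have h : ∀ i, x ∈ U i ↔ y ∈ U i := by
      intro i
      have := congrFun hxy i
      by_cases hx : x ∈ U i <;> by_cases hy : y ∈ U i <;> simp_all [charFn]
    refine hR.standardBorel.eq_of_forall_isOpen hκ.aleph0_lt.le fun O hO => ⟨fun hx => ?_, fun hy => ?_⟩
    · obtain ⟨i, hi, hiO⟩ := hbasis O hO x hx
      exact hiO ((h i).1 hi)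
    · obtain ⟨i, hi, hiO⟩ := hbasis O hO y hy
      exact hiO ((h i).2 hi)
  obtain ⟨D, hD, hDF⟩ := exists_codes_pair (a := a) (b := b) hκ hU hC hF
  have hDR : ∀ x w, (∃ ξ, D (charFn U a b x) w ξ) ↔ ∃ y, R x y ∧ w = charFn U a b y := by
    intro x w
    rw [hDF]
    constructor
    · rintro ⟨c, hx, hw⟩
      have hc : F c ∈ {p : X × X | R p.1 p.2} := hFR ▸ mem_range_self c
      exact ⟨(F c).2, by rw [hinj hx]; exact hc, hw⟩
    · rintro ⟨y, hxy, rfl⟩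
      have hxy' : (x, y) ∈ range F := by
        rw [hFR]
        exact hxy
      obtain ⟨c, hc⟩ := hxy'
      exact ⟨c, by rw [hc], by rw [hc]⟩
  -- Chains starting at a code stay among codes, and `R`, being reflexive and transitive, absorbs
  -- them.
  have hgen : ∀ x z, Relation.ReflTransGen (fun z w => ∃ ξ, D z w ξ) (charFn U a b x) z →
      ∃ y, R x y ∧ z = charFn U a b y := by
    intro x z h
    induction h with
    | refl => exact ⟨x, hR.refl x, rfl⟩
    | tail _ h ih =>
      obtain ⟨y, hxy, rfl⟩ := ih
      obtain ⟨y', hy', rfl⟩ := (hDR y _).1 h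
      exact ⟨y', hR.trans _ _ _ hxy hy', rfl⟩
  obtain ⟨n₀, c, hc, hρ⟩ := exists_node_code hκ
  obtain ⟨e, he⟩ := exists_node_enumeration hκ
  obtain ⟨φ⟩ := exists_equiv_of_mk (mk_vtx hκ he)
  let G : X → SimpleGraph (Vtx κ) := fun x => vtxGraph (LevelRel D) c n₀ (charFn U a b x)
  let iso : ∀ x, (G x).comap φ ≃g G x := fun x => SimpleGraph.Iso.comap φ (G x)
  refine ⟨fun x => (G x).comap φ, ?_, fun x y => ⟨fun hxy => ?_, ?_⟩⟩
  · intro O hO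
    obtain ⟨O', hO', rfl⟩ := isOpen_induced_iff.1 hO
    refine isBorelMap_of_coord hκ (mk_pt_prod hκ).le
      (fun x => GraphSpace.code ((G x).comap φ)) (fun p => ?_) O' hO'
    exact (isBorelSet_edge hκ hU a b _ c n₀ (φ p.1) (φ p.2)).union hκ.aleph0_lt.le
      (isBorelSet_edge hκ hU a b _ c n₀ (φ p.2) (φ p.1))
  · obtain ⟨ξ, hξ⟩ := (hDR x _).2 ⟨y, hxy, rfl⟩
    have g : G x ↪g G y := vtxEmbedding hc (ξ := ξ) fun α =>
      ⟨_, _, _, hξ, (trunc_trunc le_rfl _).symm, (trunc_trunc le_rfl _).symm,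
        (trunc_trunc le_rfl _).symm⟩
    exact ⟨((iso x).toEmbedding.trans g).trans (iso y).symm.toEmbedding⟩
  · rintro ⟨g⟩
    let g' : G x ↪g G y := ((iso x).symm.toEmbedding.trans g).trans (iso y).toEmbedding
    obtain ⟨y', hxy', hy'⟩ := hgen x _ (reflTransGen_of_embedding hκ hD hc hρ g')
    rw [hinj hy']
    exact hxy'

end Reduction

end KappaDST

theorem mainTheorem5 (κ : Cardinal.{u}) (hκ : KappaDST.IsWeaklyCompact κ) :
    KappaDST.IsCompleteAnalyticQO κ (KappaDST.GraphEmbeddable κ) :=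
  ⟨KappaDST.isAnalyticQO_graphEmbeddable hκ.isInaccessible,
    fun _ _ _ hR => KappaDST.borelReducible_graphEmbeddable hκ.isInaccessible hR⟩
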